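/- Let $n\ge 2$ and let $(M,F)$, $(M',F')$ be connected $n$-dimensional smooth Finsler manifolds (Hausdorff, second countable): $F$ is a nonnegative $C^\infty$ function on the tangent bundle without its zero section, positively $1$-homogeneous on the fibres, and $g_{ij}(x,y)=\tfrac12\,\partial^2F^2/\partial y^i\partial y^j$ is positive definite for $y\ne0$; likewise for $F'$. Let $SM$ be the bundle of rays $(x,[y])$, $y\in T_xM\setminus\{0\}$, with projection $p:SM\to M$. Let $\omega=\frac{g_{ij}y^j}{F}\,dx^i$ be the Hilbert form and $\eta(g)=\frac{(-1)^{n(n-1)/2}}{(n-1)!}\,\omega\wedge(d\omega)^{n-1}$ the volume element of $SM$. Put $N^i_j=\gamma^i_{jk}y^k-C^i_{jk}\gamma^k_{rs}y^ry^s$, where $\gamma^i_{jk}=\tfrac12g^{is}\big(\tfrac{\partial g_{sj}}{\partial x^k}-\tfrac{\partial g_{jk}}{\partial x^s}+\tfrac{\partial g_{ks}}{\partial x^j}\big)$ and $C^i_{jk}=\tfrac12 g^{is}\tfrac{\partial g_{sj}}{\partial y^k}$, put $\delta y^i=dy^i+N^i_j\,dx^j$, and let $|\cdot|$ be the norm for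 the Sasaki metric $g_{ij}\,dx^i\otimes dx^j+g_{ij}\frac{\delta y^i}{F}\otimes\frac{\delta y^j}{F}$. Let $H(M)$ be the space of continuous functions $u:M\to\mathbb R$ that have a generalized (weak) differential and satisfy $$I(u,M)=\int_{SM}|\nabla(u\circ p)|^n\,\eta(g)<\infty ,$$ and let $H_0(M)$ be the set of $u\in H(M)$ such that $u\circ p$ has compact support. For compact $C\subset M$ let $\mathrm{Cap}_M(C)=\inf I(u,M)$ over all $u\in H_0(M)$ with $0\le u\le1$ and $u=1$ on $C$. For closed $C_0,C_1\subset M$ let $\mathrm{Cap}_M(C_0,C_1)=\inf I(u,M)$ over all $u\in H(M)$ with $0\le u\le 1$, $u=0$ on $C_0$ and $u=1$ on $C_1$ ($+\infty$ if there is no such $u$). A compact continuum is a compact connected set with more than one point; a relative continuum is a closed set $C\subset M$ such that $C\cup\{\infty\}$ is connected in the Alexandrov compactification $M\cup\{\infty\}$. With values in $[0,+\infty]$ (and $\inf\emptyset=+\infty$), define * $\mu_M(x_1,x_2)=\inf \mathrm{Cap}_M(C)$ over all compact continua $C\ni x_1,x_2$; * $\lambda_M(x_1,x_2)=\inf \mathrm{Cap}_M(C_0,C_1)$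 over all relative continua $C_0\ni x_1$ and $C_1\ni x_2$; * $\nu_M(x_1,x_2,x_3)=\inf \mathrm{Cap}_M(C_0,C_1)$ over all relative continua $C_0\ni x_3$ and compact continua $C_1\ni x_1,x_2$; * $\rho_M(x_1,x_2,x_3,x_4)=+\infty$ if $\{x_1,x_2\}\cap\{x_3,x_4\}\neq\emptyset$, and otherwise $\inf \mathrm{Cap}_M(C_0,C_1)$ over all compact continua $C_0\ni x_1,x_2$ and $C_1\ni x_3,x_4$. Define the same objects for $M'$. **Theorem.** Let $f:M\to M'$ be a conformal map, that is, a $C^\infty$ diffeomorphism such that for all $x\in M$ and all nonzero $y,v,w\in T_xM$ the angle between $f_*v$ and $f_*w$ for the inner product $g'_{(f(x),f_*y)}$ equals the angle between $v$ and $w$ for $g_{(x,y)}$. Then for all $x_1,x_2,x_3,x_4\in M$ $$\rho_M(x_1,x_2,x_3,x_4)=\rho_{M'}(f(x_1),f(x_2),f(x_3),f(x_4)),\qquad \nu_M(x_1,x_2,x_3)=\nu_{M'}(f(x_1),f(x_2),f(x_3)),$$ $$\mu_M(x_1,x_2)=\mu_{M'}(f(x_1),f(x_2)),\qquad \lambda_M(x_1,x_2)=\lambda_{M'}(f(x_1),f(x_2)).$$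 -/

import Mathlib

open Set MeasureTheory
open scoped Manifold ContDiff ENNReal Topology

noncomputable section

namespace FinslerConformal

variable {n : ℕ} {M : Type*} [TopologicalSpace M] [ChartedSpace (EuclideanSpace ℝ (Fin n)) M]

/-! ### Finsler structures and conformal maps -/

/-- The fundamental tensor `g_{(x,y)}(v,w) = ½ ∂²/∂s∂t F²(x, y + s v + t w)` at `s = t = 0`. -/
def fundamentalTensor (F : TangentBundle (𝓡 n) M → ℝ) (x : M)
    (y v w : TangentSpace (𝓡 n) x) : ℝ :=
  (1 / 2) * deriv (fun s : ℝ => deriv (fun t : ℝ => F ⟨x, y + s • v + t • w⟩ ^ 2) 0) 0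

/-- A Finsler structure: a function on the slit tangent bundle `TM₀` (the values of `toFun` at zero
vectors are irrelevant and never used) which is nonnegative, smooth, positively 1-homogeneous on
the fibres, and whose fundamental tensor is positive definite. -/
structure FinslerStructure (n : ℕ) (M : Type*) [TopologicalSpace M]
    [ChartedSpace (EuclideanSpace ℝ (Fin n)) M] [IsManifold (𝓡 n) ∞ M] where
  toFun : TangentBundle (𝓡 n) M → ℝ
  nonneg : ∀ (x : M) (y : TangentSpace (𝓡 n) x), y ≠ 0 → 0 ≤ toFun ⟨x, y⟩
  smooth : ContMDiffOn (𝓡 n).tangent 𝓘(ℝ, ℝ) ∞ toFun {p | p.2 ≠ 0}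
  homogeneous : ∀ (x : M) (y : TangentSpace (𝓡 n) x) (c : ℝ), y ≠ 0 → 0 < c →
    toFun ⟨x, c • y⟩ = c * toFun ⟨x, y⟩
  posDef : ∀ (x : M) (y v : TangentSpace (𝓡 n) x), y ≠ 0 → v ≠ 0 →
    0 < fundamentalTensor toFun x y v v

/-- The angle between `v` and `w` for the inner product `g_{(x,y)}` on the fibre at `(x,y)` of the
pulled-back tangent bundle. -/
def angle (F : TangentBundle (𝓡 n) M → ℝ) (x : M) (y v w : TangentSpace (𝓡 n) x) : ℝ :=
  Real.arccos (fundamentalTensor F x y v w /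
    (√(fundamentalTensor F x y v v) * √(fundamentalTensor F x y w w)))

/-- A conformal map of Finsler manifolds: a diffeomorphism whose tangent maps preserve angles. -/
def IsConformal {M' : Type*} [TopologicalSpace M'] [ChartedSpace (EuclideanSpace ℝ (Fin n)) M']
    [IsManifold (𝓡 n) ∞ M] [IsManifold (𝓡 n) ∞ M']
    (F : FinslerStructure n M) (F' : FinslerStructure n M')
    (f : M ≃ₘ^∞⟮𝓡 n, 𝓡 n⟯ M') : Prop :=
  ∀ (x : M) (y v w : TangentSpace (𝓡 n) x), y ≠ 0 → v ≠ 0 → w ≠ 0 →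
    angle F'.toFun (f x) (mfderiv (𝓡 n) (𝓡 n) f x y) (mfderiv (𝓡 n) (𝓡 n) f x v)
      (mfderiv (𝓡 n) (𝓡 n) f x w) = angle F.toFun x y v w

/-! ### The sphere bundle -/

/-- The sphere bundle `SM`: pairs `(x, [y])` of a point and a ray of nonzero tangent vectors. -/
structure SphereBundle (n : ℕ) (M : Type*) [TopologicalSpace M]
    [ChartedSpace (EuclideanSpace ℝ (Fin n)) M] where
  pt : M
  ray : Module.Ray ℝ (TangentSpace (𝓡 n) pt)

/-- The projection `(x, y) ↦ (x, [y])` from the slit tangent bundle `TM₀` onto `SM`. -/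
def toSphereBundle (p : {p : TangentBundle (𝓡 n) M // p.2 ≠ 0}) : SphereBundle n M :=
  ⟨p.1.1, rayOfNeZero ℝ p.1.2 p.2⟩

instance sphereBundleTopology [IsManifold (𝓡 n) ∞ M] : TopologicalSpace (SphereBundle n M) :=
  TopologicalSpace.coinduced toSphereBundle inferInstance

instance sphereBundleMeasurable [IsManifold (𝓡 n) ∞ M] : MeasurableSpace (SphereBundle n M) := borel _

/-! ### Coordinate expressions

`φ` is a chart of `M`, and a point `p = (ξ, v)` of `E × E`, with `E = EuclideanSpace ℝ (Fin n)`,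
`ξ ∈ φ.target` and `v ≠ 0`, stands for the point of `TM₀` with these induced coordinates. -/

/-- The derivative at `ξ` of the inverse of a chart. -/
def dChartSymm (φ : OpenPartialHomeomorph M (EuclideanSpace ℝ (Fin n)))
    (ξ : EuclideanSpace ℝ (Fin n)) :
    EuclideanSpace ℝ (Fin n) →L[ℝ] TangentSpace (𝓡 n) (φ.symm ξ) :=
  mfderiv (𝓡 n) (𝓡 n) φ.symm ξ

/-- `F` in the induced coordinates. -/
def coordF (F : TangentBundle (𝓡 n) M → ℝ)
    (φ : OpenPartialHomeomorph M (EuclideanSpace ℝ (Fin n)))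
    (p : EuclideanSpace ℝ (Fin n) × EuclideanSpace ℝ (Fin n)) : ℝ :=
  F ⟨φ.symm p.1, dChartSymm φ p.1 p.2⟩

/-- The matrix `g_{ij}(ξ, v)`. -/
def coordG (F : TangentBundle (𝓡 n) M → ℝ)
    (φ : OpenPartialHomeomorph M (EuclideanSpace ℝ (Fin n)))
    (p : EuclideanSpace ℝ (Fin n) × EuclideanSpace ℝ (Fin n)) : Matrix (Fin n) (Fin n) ℝ :=
  Matrix.of fun i j => fundamentalTensor F (φ.symm p.1) (dChartSymm φ p.1 p.2)
    (dChartSymm φ p.1 (EuclideanSpace.single i 1)) (dChartSymm φ p.1 (EuclideanSpace.single j 1))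

/-- `∂h/∂x^k` for a function `h` of the coordinates `(x, y)`. -/
def partialX (k : Fin n) (h : EuclideanSpace ℝ (Fin n) × EuclideanSpace ℝ (Fin n) → ℝ)
    (p : EuclideanSpace ℝ (Fin n) × EuclideanSpace ℝ (Fin n)) : ℝ :=
  lineDeriv ℝ h p (EuclideanSpace.single k 1, 0)

/-- `∂h/∂y^k` for a function `h` of the coordinates `(x, y)`. -/
def partialY (k : Fin n) (h : EuclideanSpace ℝ (Fin n) × EuclideanSpace ℝ (Fin n) → ℝ)
    (p : EuclideanSpace ℝ (Fin n) × EuclideanSpace ℝ (Fin n)) : ℝ :=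
  lineDeriv ℝ h p (0, EuclideanSpace.single k 1)

/-- `γ^i_{jk} = ½ g^{is} (∂g_{sj}/∂x^k - ∂g_{jk}/∂x^s + ∂g_{ks}/∂x^j)`. -/
def christoffel (F : TangentBundle (𝓡 n) M → ℝ)
    (φ : OpenPartialHomeomorph M (EuclideanSpace ℝ (Fin n))) (i j k : Fin n)
    (p : EuclideanSpace ℝ (Fin n) × EuclideanSpace ℝ (Fin n)) : ℝ :=
  (1 / 2) * ∑ s, (coordG F φ p)⁻¹ i s *
    (partialX k (fun q => coordG F φ q s j) p - partialX s (fun q => coordG F φ q j k) p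
      + partialX j (fun q => coordG F φ q k s) p)

/-- `C^i_{jk} = g^{is} C_{sjk}` with `C_{sjk} = ½ ∂g_{sj}/∂y^k`. -/
def cartan (F : TangentBundle (𝓡 n) M → ℝ)
    (φ : OpenPartialHomeomorph M (EuclideanSpace ℝ (Fin n))) (i j k : Fin n)
    (p : EuclideanSpace ℝ (Fin n) × EuclideanSpace ℝ (Fin n)) : ℝ :=
  ∑ s, (coordG F φ p)⁻¹ i s * ((1 / 2) * partialY k (fun q => coordG F φ q s j) p)

/-- The coefficients `N^i_j = γ^i_{jk} y^k - C^i_{jk} γ^k_{rs} y^r y^s` of the nonlinear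
connection. -/
def connectionCoeff (F : TangentBundle (𝓡 n) M → ℝ)
    (φ : OpenPartialHomeomorph M (EuclideanSpace ℝ (Fin n))) (i j : Fin n)
    (p : EuclideanSpace ℝ (Fin n) × EuclideanSpace ℝ (Fin n)) : ℝ :=
  (∑ k, christoffel F φ i j k p * p.2 k)
    - ∑ k, cartan F φ i j k p * ∑ r, ∑ s, christoffel F φ k r s p * p.2 r * p.2 s

/-- The value of `δy^i = dy^i + N^i_j dx^j` on the tangent vector `Z` at `p`. -/
def deltaY (F : TangentBundle (𝓡 n) M → ℝ)
    (φ : OpenPartialHomeomorph M (EuclideanSpace ℝ (Fin n)))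
    (p Z : EuclideanSpace ℝ (Fin n) × EuclideanSpace ℝ (Fin n)) (i : Fin n) : ℝ :=
  Z.2 i + ∑ j, connectionCoeff F φ i j p * Z.1 j

/-- The Sasaki metric `g̃ = g_{ij} dx^i ⊗ dx^j + g_{ij} (δy^i / F) ⊗ (δy^j / F)` at `p`. -/
def sasaki (F : TangentBundle (𝓡 n) M → ℝ)
    (φ : OpenPartialHomeomorph M (EuclideanSpace ℝ (Fin n)))
    (p Z W : EuclideanSpace ℝ (Fin n) × EuclideanSpace ℝ (Fin n)) : ℝ :=
  (∑ i, ∑ j, coordG F φ p i j * Z.1 i * W.1 j)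
    + ∑ i, ∑ j, coordG F φ p i j *
        (deltaY F φ p Z i / coordF F φ p) * (deltaY F φ p W j / coordF F φ p)

/-- The gradient of a function with differential `θ` at `p`: the vector `Z` such that
`g̃(Z, W) = θ(W)` for all `W`. -/
def gradient (F : TangentBundle (𝓡 n) M → ℝ)
    (φ : OpenPartialHomeomorph M (EuclideanSpace ℝ (Fin n)))
    (p : EuclideanSpace ℝ (Fin n) × EuclideanSpace ℝ (Fin n))
    (θ : EuclideanSpace ℝ (Fin n) × EuclideanSpace ℝ (Fin n) →L[ℝ] ℝ) :
    EuclideanSpace ℝ (Fin n) × EuclideanSpace ℝ (Fin n) :=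
  Classical.epsilon fun Z => ∀ W, sasaki F φ p Z W = θ W

/-- `|∇u^V|` at `(x, [y])`, where `u^V = u ∘ p` is the vertical lift of a function `u` on `M` with
differential `α`, so that `du^V = α ∘ dp`. It is computed in the chart at `x`, at an arbitrary
representative `y` of the ray `[y]` (it does not depend on these choices). -/
def normGradLift (F : TangentBundle (𝓡 n) M → ℝ)
    (α : ∀ x : M, TangentSpace (𝓡 n) x →L[ℝ] ℝ) (z : SphereBundle n M) : ℝ :=
  let φ := chartAt (EuclideanSpace ℝ (Fin n)) z.pt
  let p : EuclideanSpace ℝ (Fin n) × EuclideanSpace ℝ (Fin n) :=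
    (φ z.pt, mfderiv (𝓡 n) (𝓡 n) φ z.pt z.ray.someVector)
  let θ : EuclideanSpace ℝ (Fin n) × EuclideanSpace ℝ (Fin n) →L[ℝ] ℝ :=
    ((α (φ.symm p.1)).comp (dChartSymm φ p.1)).comp (ContinuousLinearMap.fst ℝ _ _)
  √(sasaki F φ p (gradient F φ p θ) (gradient F φ p θ))

/-! ### The volume element of the sphere bundle -/

/-- The Hilbert form `ω = l_i dx^i`, with `l_i = g_{ij} y^j / F`, in the induced coordinates (that
is, pulled back to `TM₀`). -/
def hilbertForm (F : TangentBundle (𝓡 n) M → ℝ)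
    (φ : OpenPartialHomeomorph M (EuclideanSpace ℝ (Fin n)))
    (p : EuclideanSpace ℝ (Fin n) × EuclideanSpace ℝ (Fin n)) :
    EuclideanSpace ℝ (Fin n) × EuclideanSpace ℝ (Fin n) →L[ℝ] ℝ :=
  ∑ i, (∑ j, coordG F φ p i j * (p.2 j / coordF F φ p)) •
    (EuclideanSpace.proj i).comp (ContinuousLinearMap.fst ℝ _ _)

/-- The exterior derivative `dω` of the Hilbert form. -/
def dHilbertForm (F : TangentBundle (𝓡 n) M → ℝ)
    (φ : OpenPartialHomeomorph M (EuclideanSpace ℝ (Fin n)))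
    (p : EuclideanSpace ℝ (Fin n) × EuclideanSpace ℝ (Fin n)) :
    (EuclideanSpace ℝ (Fin n) × EuclideanSpace ℝ (Fin n)) [⋀^Fin 2]→L[ℝ] ℝ :=
  extDeriv (fun q => ContinuousAlternatingMap.ofSubsingleton ℝ
    (EuclideanSpace ℝ (Fin n) × EuclideanSpace ℝ (Fin n)) ℝ (0 : Fin 1) (hilbertForm F φ q)) p

/-- The value of `a ∧ b ∧ ⋯ ∧ b` (`m` factors `b`) on `2 m + 1` vectors, for a 1-form `a` and a
2-form `b`. -/
def wedgePow {V : Type*} [AddCommGroup V] [Module ℝ V] [TopologicalSpace V] (m : ℕ)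
    (a : V →L[ℝ] ℝ) (b : V [⋀^Fin 2]→L[ℝ] ℝ) (Z : Fin (2 * m + 1) → V) : ℝ :=
  (1 / 2 ^ m) * ∑ σ : Equiv.Perm (Fin (2 * m + 1)), ((Equiv.Perm.sign σ : ℤ) : ℝ) *
    (a (Z (σ 0)) * ∏ k : Fin m,
      b ![Z (σ ⟨2 * k.1 + 1, by omega⟩), Z (σ ⟨2 * k.1 + 2, by omega⟩)])

/-- The form `η(g) = ((-1)^N / (n-1)!) ω ∧ (dω)^{n-1}`, `N = n(n-1)/2`, evaluated at `p` on
`2 n - 1` vectors. -/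
def volumeForm (F : TangentBundle (𝓡 n) M → ℝ)
    (φ : OpenPartialHomeomorph M (EuclideanSpace ℝ (Fin n)))
    (p : EuclideanSpace ℝ (Fin n) × EuclideanSpace ℝ (Fin n))
    (Z : Fin (2 * (n - 1) + 1) → EuclideanSpace ℝ (Fin n) × EuclideanSpace ℝ (Fin n)) : ℝ :=
  ((-1) ^ (n * (n - 1) / 2) / (Nat.factorial (n - 1) : ℝ)) *
    wedgePow (n - 1) (hilbertForm F φ p) (dHilbertForm F φ p) Z

/-- The vectors `(e_1, 0), …, (e_n, 0), (0, t_1), …, (0, t_{n-1})` (for `n ≥ 1`; the last branch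
does not occur then). -/
def frame (t : Fin (n - 1) → EuclideanSpace ℝ (Fin n)) (i : Fin (2 * (n - 1) + 1)) :
    EuclideanSpace ℝ (Fin n) × EuclideanSpace ℝ (Fin n) :=
  if h : i.1 < n then (EuclideanSpace.single ⟨i.1, h⟩ 1, 0)
  else if h' : i.1 - n < n - 1 then (0, t ⟨i.1 - n, h'⟩) else 0

/-- The density of `η(g)` with respect to Lebesgue measure times the surface measure of the
Euclidean unit sphere: the absolute value of `η(g)` on the coordinate vectors `e_1, …, e_n` and an
orthonormal basis `t` of the tangent space at `θ` of the unit sphere (all choices of `t` give the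
same value). -/
def density (F : TangentBundle (𝓡 n) M → ℝ)
    (φ : OpenPartialHomeomorph M (EuclideanSpace ℝ (Fin n)))
    (ξ θ : EuclideanSpace ℝ (Fin n)) : ℝ≥0∞ :=
  ⨆ t : {t : Fin (n - 1) → EuclideanSpace ℝ (Fin n) //
      Orthonormal ℝ t ∧ ∀ j, inner ℝ (t j) θ = 0},
    ENNReal.ofReal |volumeForm F φ (ξ, θ) (frame t.1)|

theorem dChartSymm_ne_zero [IsManifold (𝓡 n) ∞ M]
    {φ : OpenPartialHomeomorph M (EuclideanSpace ℝ (Fin n))}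
    (hφ : φ ∈ IsManifold.maximalAtlas (𝓡 n) ∞ M) {ξ : EuclideanSpace ℝ (Fin n)}
    (hξ : ξ ∈ φ.target) {v : EuclideanSpace ℝ (Fin n)} (hv : v ≠ 0) :
    dChartSymm φ ξ v ≠ 0 := by
  have hmd : φ.MDifferentiable (𝓡 n) (𝓡 n) :=
    ⟨(contMDiffOn_of_mem_maximalAtlas hφ).mdifferentiableOn (by simp),
      (contMDiffOn_symm_of_mem_maximalAtlas hφ).mdifferentiableOn (by simp)⟩
  intro h
  have hinj := hmd.symm.mfderiv_injective (x := ξ) hξ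
  exact hv (hinj (h.trans (map_zero (mfderiv (𝓡 n) (𝓡 n) φ.symm ξ)).symm))

/-- The parametrization of `SM` over the domain of a chart `φ` by `φ.target × S^{n-1}`. -/
def sphereParam [IsManifold (𝓡 n) ∞ M]
    (φ : IsManifold.maximalAtlas (𝓡 n) ∞ M)
    (q : φ.1.target × Metric.sphere (0 : EuclideanSpace ℝ (Fin n)) 1) : SphereBundle n M :=
  ⟨φ.1.symm q.1, rayOfNeZero ℝ (dChartSymm φ.1 q.1.1 q.2.1)
    (dChartSymm_ne_zero φ.2 q.1.2 (ne_zero_of_mem_unit_sphere q.2))⟩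

/-- The restriction to the part of `SM` over the domain of the chart `φ` of the measure of the
volume element `η(g)`. -/
def chartVolume [IsManifold (𝓡 n) ∞ M] (F : FinslerStructure n M)
    (φ : IsManifold.maximalAtlas (𝓡 n) ∞ M) : Measure (SphereBundle n M) :=
  Measure.map (sphereParam φ)
    (((Measure.comap Subtype.val volume : Measure φ.1.target).prod
      (volume : Measure (EuclideanSpace ℝ (Fin n))).toSphere).withDensity
        fun q => density F.toFun φ.1 q.1.1 q.2.1)

/-- The measure on `SM` of the volume element `η(g)`. It is the least measure which is at least
`chartVolume F φ` for every chart `φ`: the measures `chartVolume F φ` are the restrictions of one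
measure to open sets, countably many of which cover `SM`, and this measure is their supremum. -/
def sphereVolume [IsManifold (𝓡 n) ∞ M] (F : FinslerStructure n M) :
    Measure (SphereBundle n M) :=
  ⨆ φ : IsManifold.maximalAtlas (𝓡 n) ∞ M, chartVolume F φ

/-! ### Generalized differentials, the energy `I(u, M)` and capacities -/

/-- `α` is a generalized differential of the continuous function `u`: in every chart of the smooth
structure, its coordinate expression is locally integrable and is the weak derivative of the
coordinate expression of `u`. -/
def IsWeakDifferential [IsManifold (𝓡 n) ∞ M] (u : M → ℝ)
    (α : ∀ x : M, TangentSpace (𝓡 n) x →L[ℝ] ℝ) : Prop :=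
  ∀ φ ∈ IsManifold.maximalAtlas (𝓡 n) ∞ M,
    LocallyIntegrableOn
      (fun ξ => ((α (φ.symm ξ)).comp (dChartSymm φ ξ) : EuclideanSpace ℝ (Fin n) →L[ℝ] ℝ))
      φ.target volume ∧
    ∀ ψ : EuclideanSpace ℝ (Fin n) → ℝ, ContDiff ℝ ∞ ψ → HasCompactSupport ψ →
      tsupport ψ ⊆ φ.target → ∀ e : EuclideanSpace ℝ (Fin n),
        ∫ ξ, u (φ.symm ξ) * fderiv ℝ ψ ξ e = -∫ ξ, α (φ.symm ξ) (dChartSymm φ ξ e) * ψ ξ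

/-- `I(u, M) = ∫_{SM} |∇u^V|^n η(g)`. The generalized differential of `u` is unique up to null
sets, so all `α` give the same integral; the value is `∞` if `u` has no generalized
differential. -/
def energy [IsManifold (𝓡 n) ∞ M] (F : FinslerStructure n M) (u : M → ℝ) : ℝ≥0∞ :=
  ⨅ (α : ∀ x : M, TangentSpace (𝓡 n) x →L[ℝ] ℝ) (_ : IsWeakDifferential u α),
    ∫⁻ z, ENNReal.ofReal (normGradLift F.toFun α z ^ n) ∂(sphereVolume F)

/-- `H(M)`: the continuous functions which have a generalized differential, with
`I(u, M) < ∞`. -/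
def H [IsManifold (𝓡 n) ∞ M] (F : FinslerStructure n M) : Set (M → ℝ) :=
  {u | Continuous u ∧ (∃ α, IsWeakDifferential (n := n) u α) ∧ energy F u < ⊤}

/-- `H₀(M)`: the functions in `H(M)` whose vertical lift `u^V` has compact support in `SM`. -/
def H₀ [IsManifold (𝓡 n) ∞ M] (F : FinslerStructure n M) : Set (M → ℝ) :=
  {u | u ∈ H F ∧ HasCompactSupport fun z : SphereBundle n M => u z.pt}

/-- The capacity of a compact set `C`. -/
def cap [IsManifold (𝓡 n) ∞ M] (F : FinslerStructure n M) (C : Set M) : ℝ≥0∞ :=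
  ⨅ u ∈ {u | u ∈ H₀ F ∧ (∀ x ∈ C, u x = 1) ∧ ∀ x, 0 ≤ u x ∧ u x ≤ 1}, energy F u

/-- The capacity of the condenser of two closed sets; it is `∞` if there is no admissible
function. -/
def condenserCap [IsManifold (𝓡 n) ∞ M] (F : FinslerStructure n M) (C₀ C₁ : Set M) : ℝ≥0∞ :=
  ⨅ u ∈ {u | u ∈ H F ∧ (∀ x ∈ C₀, u x = 0) ∧ (∀ x ∈ C₁, u x = 1) ∧ ∀ x, 0 ≤ u x ∧ u x ≤ 1},
    energy F u

/-! ### Continua and the four functions -/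

/-- A relative continuum: a closed set `C` such that `C ∪ {∞}` is connected in the Alexandrov
compactification. -/
def IsRelativeContinuum {X : Type*} [TopologicalSpace X] (C : Set X) : Prop :=
  IsClosed C ∧ IsConnected (((↑) '' C ∪ {OnePoint.infty} : Set (OnePoint X)))

/-- A compact continuum: a closed connected set, not reduced to one point, which is compact. -/
def IsCompactContinuum {X : Type*} [TopologicalSpace X] (C : Set X) : Prop :=
  IsClosed C ∧ IsConnected C ∧ C.Nontrivial ∧ IsCompact C

/-- The function `μ_M`. -/
def mu [IsManifold (𝓡 n) ∞ M] (F : FinslerStructure n M) (x₁ x₂ : M) : ℝ≥0∞ :=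
  ⨅ C ∈ {C : Set M | IsCompactContinuum C ∧ x₁ ∈ C ∧ x₂ ∈ C}, cap F C

/-- The function `λ_M`. -/
def lam [IsManifold (𝓡 n) ∞ M] (F : FinslerStructure n M) (x₁ x₂ : M) : ℝ≥0∞ :=
  ⨅ C₀ ∈ {C : Set M | IsRelativeContinuum C ∧ x₁ ∈ C},
    ⨅ C₁ ∈ {C : Set M | IsRelativeContinuum C ∧ x₂ ∈ C}, condenserCap F C₀ C₁

/-- The function `ν_M` (of interest at triples which are not of the form `(x, x, x)`; there the
infimum is `∞`, because no function is admissible). -/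
def nu [IsManifold (𝓡 n) ∞ M] (F : FinslerStructure n M) (x₁ x₂ x₃ : M) : ℝ≥0∞ :=
  ⨅ C₀ ∈ {C : Set M | IsRelativeContinuum C ∧ x₃ ∈ C},
    ⨅ C₁ ∈ {C : Set M | IsCompactContinuum C ∧ x₁ ∈ C ∧ x₂ ∈ C}, condenserCap F C₀ C₁

open Classical in
/-- The function `ρ_M` (of interest at quadruples without three equal coordinates; at the others the
value is `∞`). -/
def rho [IsManifold (𝓡 n) ∞ M] (F : FinslerStructure n M) (x₁ x₂ x₃ x₄ : M) : ℝ≥0∞ :=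
  if (({x₁, x₂} : Set M) ∩ {x₃, x₄}).Nonempty then ⊤
  else ⨅ C₀ ∈ {C : Set M | IsCompactContinuum C ∧ x₁ ∈ C ∧ x₂ ∈ C},
    ⨅ C₁ ∈ {C : Set M | IsCompactContinuum C ∧ x₃ ∈ C ∧ x₄ ∈ C}, condenserCap F C₀ C₁

end FinslerConformal

end

/-!
# Conformal invariance of the four capacity functions of a Finsler manifold

Everything follows from the invariance of the energy, `IsConformal.energy_comp`: `u ↦ u ∘ f` is then
a bijection between the admissible functions which preserves `I`, and `f`, being a homeomorphism,
maps continua to continua. By symmetry (`IsConformal.symm`) only inequalities have to be proved.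

Put `s(x, y) = F'(f x, f_* y) / F(x, y)`. A map that preserves angles preserves orthogonality, so the
inner products `g'_{(f x, f_* y)}` and `g_{(x, y)}` are proportional, and Euler's relation
`g_{(x, y)}(y, y) = F(x, y)²` identifies the factor as `s²` (`IsConformal.metric_eq`). It need not be
known that `s` depends on `x` only. Two computations remain.

* The gradient of the vertical lift of `u` for the Sasaki metric is the horizontal lift of the vector
  that represents `du` for `g_{(x, y)}` (`normGradLift_eq`). Hence its norm is divided by `s`
  (`IsConformal.normGradLift_mul`), and the nonlinear connection plays no role.
* In corresponding charts the Hilbert form `ω` becomes `s ω`. Since `d(s ω) = s dω + ds ∧ ω` and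
  `ω ∧ ω = 0`, the form `ω ∧ (dω)^{n-1}` is multiplied by `s^n` (`wedgePow_smul`,
  `IsConformal.volumeForm_transportChart`).

So the integrand `|∇(u ∘ p)|^n η(g)` is invariant. For the measures this says that the volume of `F'`
is, over every chart, the image of the volume of `F` with density `s^n`, a relation that passes to
the supremum over all charts (`IsConformal.sphereVolume_le`). Generalized differentials correspond
because `u ∘ f` in a chart `φ` and `u` in the chart `φ ∘ f⁻¹` have the same coordinate expressions
(`IsWeakDifferential.comp`).
-/

noncomputable section

namespace FinslerConformal

/-! ### Second derivatives and exterior derivatives -/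

/-- The iterated partial derivative in the directions `a` and `b` is the second derivative evaluated
at `a` and `b`. -/
theorem deriv_deriv_eq_fderiv_fderiv {V : Type*} [NormedAddCommGroup V] [NormedSpace ℝ V]
    {h : V → ℝ} {p : V} (hh : ContDiffAt ℝ 2 h p) (a b : V) :
    deriv (fun s : ℝ => deriv (fun t : ℝ => h (p + s • a + t • b)) 0) 0 =
      fderiv ℝ (fderiv ℝ h) p a b := by
  have hline : HasDerivAt (fun s : ℝ => p + s • a) a 0 := by
    simpa using ((hasDerivAt_id (0 : ℝ)).smul_const a).const_add p
  have hcont : Filter.Tendsto (fun s : ℝ => p + s • a) (𝓝 0) (𝓝 p) := by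
    simpa using hline.continuousAt.tendsto
  have hev : ∀ᶠ q in 𝓝 p, DifferentiableAt ℝ h q := by
    filter_upwards [hh.eventually (by simp)] with q hq
    exact hq.differentiableAt (by simp)
  have h1 : (fun s : ℝ => deriv (fun t : ℝ => h (p + s • a + t • b)) 0) =ᶠ[𝓝 0]
      fun s => fderiv ℝ h (p + s • a) b := by
    filter_upwards [hcont.eventually hev] with s hs
    have hl : HasDerivAt (fun t : ℝ => p + s • a + t • b) b 0 := by
      simpa using ((hasDerivAt_id (0 : ℝ)).smul_const b).const_add (p + s • a)
    have h0 : p + s • a + (0 : ℝ) • b = p + s • a := by simp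
    exact (HasFDerivAt.comp_hasDerivAt (0 : ℝ) (by rw [h0]; exact hs.hasFDerivAt) hl).deriv
  rw [h1.deriv_eq]
  have hd : DifferentiableAt ℝ (fderiv ℝ h) p :=
    (hh.fderiv_right (m := 1) (by norm_num)).differentiableAt (by simp)
  have h0 : p + (0 : ℝ) • a = p := by simp
  have := HasFDerivAt.comp_hasDerivAt (0 : ℝ) (by rw [h0]; exact hd.hasFDerivAt) hline
  exact (this.clm_apply (hasDerivAt_const (0 : ℝ) b)).deriv.trans (by simp)

theorem extDeriv_ofSubsingleton_apply {V : Type*} [NormedAddCommGroup V] [NormedSpace ℝ V]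
    {θ : V → V →L[ℝ] ℝ} {p : V} (hθ : DifferentiableAt ℝ θ p) (X Y : V) :
    extDeriv (fun q => ContinuousAlternatingMap.ofSubsingleton ℝ V ℝ (0 : Fin 1) (θ q)) p ![X, Y] =
      fderiv ℝ θ p X Y - fderiv ℝ θ p Y X := by
  have hd : DifferentiableAt ℝ
      (fun q => ContinuousAlternatingMap.ofSubsingleton ℝ V ℝ (0 : Fin 1) (θ q)) p :=
    (ContinuousAlternatingMap.ofSubsingletonLIE (𝕜 := ℝ) (E := V) (F := ℝ)
      (0 : Fin 1)).differentiableAt.comp p hθ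
  rw [extDeriv_apply hd, Fin.sum_univ_two]
  have h : ∀ Z W : V, fderiv ℝ (fun q => θ q Z) p W = fderiv ℝ θ p W Z := by
    intro Z W
    rw [fderiv_clm_apply hθ (differentiableAt_const Z)]
    simp
  simp [Fin.removeNth, h, sub_eq_add_neg]

/-- `d(s θ) = s dθ + ds ∧ θ` for a function `s` and a one-form `θ`. -/
theorem extDeriv_smul_ofSubsingleton_apply {V : Type*} [NormedAddCommGroup V] [NormedSpace ℝ V]
    {θ : V → V →L[ℝ] ℝ} {s : V → ℝ} {p : V} (hs : DifferentiableAt ℝ s p)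
    (hθ : DifferentiableAt ℝ θ p) (X Y : V) :
    extDeriv (fun q => ContinuousAlternatingMap.ofSubsingleton ℝ V ℝ (0 : Fin 1) (s q • θ q)) p
        ![X, Y] =
      s p * extDeriv (fun q => ContinuousAlternatingMap.ofSubsingleton ℝ V ℝ (0 : Fin 1) (θ q)) p
        ![X, Y] + (fderiv ℝ s p X * θ p Y - fderiv ℝ s p Y * θ p X) := by
  rw [extDeriv_ofSubsingleton_apply (θ := fun q => s q • θ q) (hs.smul hθ), extDeriv_ofSubsingleton_apply hθ,
    show fderiv ℝ (fun q => s q • θ q) p = _ from fderiv_smul hs hθ]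
  simp
  ring

/-! ### Powers of a two-form wedged with a one-form -/

/-- An alternating sum of a function of permutations that is invariant under a transposition of the
arguments vanishes. -/
theorem sum_sign_mul_eq_zero {m : ℕ} (G : Equiv.Perm (Fin m) → ℝ) {i j : Fin m} (hij : i ≠ j)
    (hG : ∀ σ, G (σ * Equiv.swap i j) = G σ) :
    ∑ σ, ((Equiv.Perm.sign σ : ℤ) : ℝ) * G σ = 0 := by
  have h := Equiv.sum_comp (Equiv.mulRight (Equiv.swap i j))
    (fun σ => ((Equiv.Perm.sign σ : ℤ) : ℝ) * G σ)
  simp only [Equiv.coe_mulRight, hG, Equiv.Perm.sign_mul, Equiv.Perm.sign_swap hij] at h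
  simp only [mul_neg, mul_one, Units.val_neg, Int.cast_neg, neg_mul, Finset.sum_neg_distrib] at h
  linarith

/-- Changing a two-form `b` by a multiple `β ∧ a` of the one-form `a` does not change
`a ∧ b ∧ ⋯ ∧ b`, because `a ∧ a = 0`. -/
theorem wedgePow_smul {V : Type*} [AddCommGroup V] [Module ℝ V] [TopologicalSpace V] (m : ℕ)
    (s : ℝ) (a a' : V →L[ℝ] ℝ) (b b' : V [⋀^Fin 2]→L[ℝ] ℝ) (β : V → ℝ)
    (ha : ∀ X, a' X = s * a X)
    (hb : ∀ X Y, b' ![X, Y] = s * b ![X, Y] + (β X * a Y - β Y * a X))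
    (Z : Fin (2 * m + 1) → V) :
    wedgePow m a' b' Z = s ^ (m + 1) * wedgePow m a b Z := by
  -- the factors `b'` are replaced by `s b` one at a time
  have key : ∀ k : ℕ, k ≤ m →
      ∑ σ : Equiv.Perm (Fin (2 * m + 1)), ((Equiv.Perm.sign σ : ℤ) : ℝ) *
        (a (Z (σ 0)) * ∏ l : Fin m, (if l.1 < k then
          b' ![Z (σ ⟨2 * l.1 + 1, by omega⟩), Z (σ ⟨2 * l.1 + 2, by omega⟩)]
          else s * b ![Z (σ ⟨2 * l.1 + 1, by omega⟩), Z (σ ⟨2 * l.1 + 2, by omega⟩)])) =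
      ∑ σ : Equiv.Perm (Fin (2 * m + 1)), ((Equiv.Perm.sign σ : ℤ) : ℝ) *
        (a (Z (σ 0)) * ∏ l : Fin m,
          (s * b ![Z (σ ⟨2 * l.1 + 1, by omega⟩), Z (σ ⟨2 * l.1 + 2, by omega⟩)])) := by
    intro k
    induction k with
    | zero => intro _; simp
    | succ k ih =>
      intro hk
      rw [← ih (by omega), ← sub_eq_zero, ← Finset.sum_sub_distrib]
      set k' : Fin m := ⟨k, by omega⟩ with hk'
      -- the product of the factors which do not involve the positions `0, 2 k + 1, 2 k + 2`
      let R : Equiv.Perm (Fin (2 * m + 1)) → ℝ := fun σ => ∏ l ∈ Finset.univ.erase k',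
        (if l.1 < k then
          b' ![Z (σ ⟨2 * l.1 + 1, by omega⟩), Z (σ ⟨2 * l.1 + 2, by omega⟩)]
          else s * b ![Z (σ ⟨2 * l.1 + 1, by omega⟩), Z (σ ⟨2 * l.1 + 2, by omega⟩)])
      let i₁ : Fin (2 * m + 1) := ⟨2 * k + 1, by omega⟩
      let i₂ : Fin (2 * m + 1) := ⟨2 * k + 2, by omega⟩
      have hne : ∀ (l : Fin m), l ≠ k' → ∀ j : Fin (2 * m + 1), (j = i₁ ∨ j = i₂) →
          ∀ σ : Equiv.Perm (Fin (2 * m + 1)),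
          (σ * Equiv.swap 0 j) ⟨2 * l.1 + 1, by omega⟩ = σ ⟨2 * l.1 + 1, by omega⟩ ∧
          (σ * Equiv.swap 0 j) ⟨2 * l.1 + 2, by omega⟩ = σ ⟨2 * l.1 + 2, by omega⟩ := by
        intro l hl j hj σ
        have hl' : l.1 ≠ k := fun h => hl (Fin.ext h)
        have hj' : j.1 = 2 * k + 1 ∨ j.1 = 2 * k + 2 := by
          rcases hj with rfl | rfl <;> simp [i₁, i₂]
        constructor <;>
        · rw [Equiv.Perm.mul_apply, Equiv.swap_apply_of_ne_of_ne]
          · intro h; have := congrArg Fin.val h; simp at this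
          · intro h; have := congrArg Fin.val h; simp at this; omega
      have hR : ∀ j : Fin (2 * m + 1), (j = i₁ ∨ j = i₂) → ∀ σ,
          R (σ * Equiv.swap 0 j) = R σ := by
        intro j hj σ
        refine Finset.prod_congr rfl fun l hl => ?_
        obtain ⟨h1, h2⟩ := hne l (Finset.ne_of_mem_erase hl) j hj σ
        rw [h1, h2]
      have h01 : (0 : Fin (2 * m + 1)) ≠ i₁ := fun h => by
        have := congrArg Fin.val h; simp [i₁] at this
      have h02 : (0 : Fin (2 * m + 1)) ≠ i₂ := fun h => by
        have := congrArg Fin.val h; simp [i₂] at this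
      have h12 : i₁ ≠ i₂ := fun h => by
        have := congrArg Fin.val h; simp [i₁, i₂] at this
      -- both terms of `a ∧ (β ∧ a)` contain `a` twice, so transposing its arguments cancels them
      have z1 := sum_sign_mul_eq_zero
        (fun σ => a (Z (σ 0)) * (β (Z (σ i₁)) * a (Z (σ i₂))) * R σ) h02 (by
          intro σ
          simp only [hR i₂ (Or.inr rfl), Equiv.Perm.mul_apply, Equiv.swap_apply_left,
            Equiv.swap_apply_right, Equiv.swap_apply_of_ne_of_ne h01.symm h12]
          ring)
      have z2 := sum_sign_mul_eq_zero
        (fun σ => a (Z (σ 0)) * (β (Z (σ i₂)) * a (Z (σ i₁))) * R σ) h01 (by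
          intro σ
          simp only [hR i₁ (Or.inl rfl), Equiv.Perm.mul_apply, Equiv.swap_apply_left,
            Equiv.swap_apply_right, Equiv.swap_apply_of_ne_of_ne h02.symm h12.symm]
          ring)
      have z := congrArg₂ (· - ·) z1 z2
      simp only [← Finset.sum_sub_distrib, sub_zero] at z
      refine Eq.trans (Finset.sum_congr rfl fun σ _ => ?_) z
      rw [← Finset.mul_prod_erase Finset.univ _ (Finset.mem_univ k'),
        ← Finset.mul_prod_erase Finset.univ
          (fun l : Fin m => if l.1 < k then
            b' ![Z (σ ⟨2 * l.1 + 1, by omega⟩), Z (σ ⟨2 * l.1 + 2, by omega⟩)]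
            else s * b ![Z (σ ⟨2 * l.1 + 1, by omega⟩), Z (σ ⟨2 * l.1 + 2, by omega⟩)])
          (Finset.mem_univ k')]
      have hR1 : ∏ l ∈ Finset.univ.erase k', (if l.1 < k + 1 then
          b' ![Z (σ ⟨2 * l.1 + 1, by omega⟩), Z (σ ⟨2 * l.1 + 2, by omega⟩)]
          else s * b ![Z (σ ⟨2 * l.1 + 1, by omega⟩), Z (σ ⟨2 * l.1 + 2, by omega⟩)]) = R σ := by
        refine Finset.prod_congr rfl fun l hl => ?_
        have : l.1 ≠ k := fun h => Finset.ne_of_mem_erase hl (Fin.ext h)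
        have : l.1 < k + 1 ↔ l.1 < k := by omega
        simp only [this]
      rw [hR1]
      change _ * (_ * ((if k < k + 1 then _ else _) * _)) -
        _ * (_ * ((if k < k then _ else _) * R σ)) = _
      rw [if_pos (Nat.lt_succ_self k), if_neg (lt_irrefl k), hb]
      simp only [hk', i₁, i₂]
      ring
  have h := key m le_rfl
  simp only [Fin.is_lt, if_true, Finset.prod_mul_distrib, Finset.prod_const, Finset.card_univ,
    Fintype.card_fin] at h
  simp only [wedgePow, ha, mul_assoc s]
  have e1 : ∀ σ : Equiv.Perm (Fin (2 * m + 1)), ((Equiv.Perm.sign σ : ℤ) : ℝ) * (s *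
      (a (Z (σ 0)) * ∏ k : Fin m,
        b' ![Z (σ ⟨2 * k.1 + 1, by omega⟩), Z (σ ⟨2 * k.1 + 2, by omega⟩)])) =
      s * (((Equiv.Perm.sign σ : ℤ) : ℝ) * (a (Z (σ 0)) * ∏ k : Fin m,
        b' ![Z (σ ⟨2 * k.1 + 1, by omega⟩), Z (σ ⟨2 * k.1 + 2, by omega⟩)])) := fun σ => by ring
  rw [Finset.sum_congr rfl fun σ _ => e1 σ, ← Finset.mul_sum, h, Finset.mul_sum, Finset.mul_sum,
    Finset.mul_sum, Finset.mul_sum]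
  exact Finset.sum_congr rfl fun σ _ => by ring

/-! ### Measures with density -/

theorem withDensity_mono_left {X : Type*} [MeasurableSpace X] {μ ν : Measure X} (h : μ ≤ ν)
    (f : X → ℝ≥0∞) : μ.withDensity f ≤ ν.withDensity f :=
  Measure.le_iff.2 fun s hs => by
    rw [withDensity_apply _ hs, withDensity_apply _ hs]
    exact lintegral_mono' (Measure.restrict_mono_measure h s) le_rfl

/-- The chain rule for densities, for a factor `f` which need not be measurable. -/
theorem withDensity_mul_of_pos {X : Type*} [MeasurableSpace X] (μ : Measure X) [SFinite μ]
    (f g : X → ℝ≥0∞) (hg : Measurable g) (hg0 : ∀ x, g x ≠ 0) (hgt : ∀ x, g x ≠ ⊤) :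
    μ.withDensity (f * g) = (μ.withDensity f).withDensity g := by
  apply le_antisymm
  · obtain ⟨k, hk, hkle, hkeq⟩ := exists_measurable_le_withDensity_eq μ (f * g)
    have hle : k * g⁻¹ ≤ f := fun x => by
      have h := hkle x
      rw [Pi.mul_apply] at h
      rw [Pi.mul_apply, Pi.inv_apply, ← div_eq_mul_inv]
      exact ENNReal.div_le_of_le_mul h
    have hk' : k = (k * g⁻¹) * g := by
      ext x
      simp only [Pi.mul_apply, Pi.inv_apply, mul_assoc, ENNReal.inv_mul_cancel (hg0 x) (hgt x),
        mul_one]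
    rw [← hkeq, hk', withDensity_mul _ (hk.mul hg.inv) hg]
    exact withDensity_mono_left (withDensity_mono (ae_of_all _ hle)) g
  · obtain ⟨k, hk, hkle, hkeq⟩ := exists_measurable_le_withDensity_eq μ f
    rw [← hkeq, ← withDensity_mul _ hk hg]
    exact withDensity_mono (ae_of_all _ fun x => mul_le_mul_left (hkle x) _)

/-! ### The fundamental tensor in induced coordinates -/

theorem isOpen_target_prod {X V : Type*} [TopologicalSpace X] [NormedAddCommGroup V]
    (φ : OpenPartialHomeomorph X V) : IsOpen (φ.target ×ˢ ({0}ᶜ : Set V)) :=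
  φ.open_target.prod isOpen_compl_singleton

theorem eventually_add_smul_ne_zero {V : Type*} [AddCommGroup V] [Module ℝ V]
    [TopologicalSpace V] [ContinuousAdd V] [ContinuousSMul ℝ V] [T1Space V] {y : V} (hy : y ≠ 0)
    (v : V) : ∀ᶠ s : ℝ in 𝓝 0, y + s • v ≠ 0 := by
  have h : Continuous fun s : ℝ => y + s • v := by fun_prop
  exact h.continuousAt.eventually_ne (by simpa using hy)

section Coordinates

variable {n : ℕ} {M : Type*} [TopologicalSpace M] [ChartedSpace (EuclideanSpace ℝ (Fin n)) M]

theorem mdifferentiable_of_mem_maximalAtlas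
    {φ : OpenPartialHomeomorph M (EuclideanSpace ℝ (Fin n))}
    (hφ : φ ∈ IsManifold.maximalAtlas (𝓡 n) ∞ M) : φ.MDifferentiable (𝓡 n) (𝓡 n) :=
  ⟨(contMDiffOn_of_mem_maximalAtlas hφ).mdifferentiableOn (by simp),
    (contMDiffOn_symm_of_mem_maximalAtlas hφ).mdifferentiableOn (by simp)⟩

theorem dChartSymm_surjective {φ : OpenPartialHomeomorph M (EuclideanSpace ℝ (Fin n))}
    (hφ : φ ∈ IsManifold.maximalAtlas (𝓡 n) ∞ M) {ξ : EuclideanSpace ℝ (Fin n)}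
    (hξ : ξ ∈ φ.target) : Function.Surjective (dChartSymm φ ξ) :=
  (mdifferentiable_of_mem_maximalAtlas hφ).symm.mfderiv_surjective hξ

theorem exists_dChartSymm_eq {φ : OpenPartialHomeomorph M (EuclideanSpace ℝ (Fin n))}
    (hφ : φ ∈ IsManifold.maximalAtlas (𝓡 n) ∞ M) {ξ : EuclideanSpace ℝ (Fin n)}
    (hξ : ξ ∈ φ.target) {y : TangentSpace (𝓡 n) (φ.symm ξ)} (hy : y ≠ 0) :
    ∃ v ≠ 0, dChartSymm φ ξ v = y := by
  obtain ⟨v, rfl⟩ := dChartSymm_surjective hφ hξ y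
  exact ⟨v, fun h => hy (by rw [h, map_zero]), rfl⟩

instance tangentSpaceT1 (x : M) : T1Space (TangentSpace (𝓡 n) x) :=
  inferInstanceAs (T1Space (EuclideanSpace ℝ (Fin n)))

variable [IsManifold (𝓡 n) ∞ M]

/-- The parametrization of the tangent bundle by induced coordinates is smooth. -/
theorem contMDiffOn_inducedCoordinates
    {φ : OpenPartialHomeomorph M (EuclideanSpace ℝ (Fin n))}
    (hφ : φ ∈ IsManifold.maximalAtlas (𝓡 n) ∞ M) :
    ContMDiffOn 𝓘(ℝ, EuclideanSpace ℝ (Fin n) × EuclideanSpace ℝ (Fin n)) (𝓡 n).tangent ∞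
      (fun p => (⟨φ.symm p.1, dChartSymm φ p.1 p.2⟩ : TangentBundle (𝓡 n) M))
      (φ.target ×ˢ univ) := by
  have h1 := (contMDiffOn_symm_of_mem_maximalAtlas hφ).contMDiffOn_tangentMapWithin
    (m := ∞) (by simp) φ.open_target.uniqueMDiffOn
  have h2 : ContMDiff 𝓘(ℝ, EuclideanSpace ℝ (Fin n) × EuclideanSpace ℝ (Fin n)) (𝓡 n).tangent ∞
      (fun p : EuclideanSpace ℝ (Fin n) × EuclideanSpace ℝ (Fin n) =>
        (⟨p.1, p.2⟩ : TangentBundle (𝓡 n) (EuclideanSpace ℝ (Fin n)))) := by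
    intro p
    rw [Bundle.contMDiffAt_totalSpace]
    refine ⟨contDiff_fst.contMDiff p, ?_⟩
    simp only [trivializationAt_model_space_apply]
    exact contDiff_snd.contMDiff p
  have h3 := h1.comp (t := Bundle.TotalSpace.proj ⁻¹' φ.target) (s := φ.target ×ˢ univ)
    h2.contMDiffOn (fun p hp => hp.1)
  refine h3.congr fun p hp => ?_
  have hp' : p.1 ∈ φ.target := hp.1
  show _ = tangentMapWithin (𝓡 n) (𝓡 n) φ.symm φ.target ⟨p.1, p.2⟩
  simp only [tangentMapWithin, mfderivWithin_of_isOpen φ.open_target hp']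
  rfl

theorem contDiffOn_coordF (F : FinslerStructure n M)
    {φ : OpenPartialHomeomorph M (EuclideanSpace ℝ (Fin n))}
    (hφ : φ ∈ IsManifold.maximalAtlas (𝓡 n) ∞ M) :
    ContDiffOn ℝ ∞ (coordF F.toFun φ) (φ.target ×ˢ {0}ᶜ) := by
  rw [← contMDiffOn_iff_contDiffOn]
  refine F.smooth.comp ((contMDiffOn_inducedCoordinates hφ).mono
    (prod_mono le_rfl (subset_univ _))) fun p hp => ?_
  exact dChartSymm_ne_zero hφ hp.1 hp.2

theorem contDiffAt_coordF (F : FinslerStructure n M)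
    {φ : OpenPartialHomeomorph M (EuclideanSpace ℝ (Fin n))}
    (hφ : φ ∈ IsManifold.maximalAtlas (𝓡 n) ∞ M)
    {p : EuclideanSpace ℝ (Fin n) × EuclideanSpace ℝ (Fin n)} (hp : p.1 ∈ φ.target)
    (hp2 : p.2 ≠ 0) : ContDiffAt ℝ ∞ (coordF F.toFun φ) p :=
  (contDiffOn_coordF F hφ).contDiffAt ((isOpen_target_prod φ).mem_nhds ⟨hp, hp2⟩)

/-- The fundamental tensor is half of the vertical part of the second derivative of `F²`. -/
theorem fundamentalTensor_eq_fderiv (F : FinslerStructure n M)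
    {φ : OpenPartialHomeomorph M (EuclideanSpace ℝ (Fin n))}
    (hφ : φ ∈ IsManifold.maximalAtlas (𝓡 n) ∞ M)
    {p : EuclideanSpace ℝ (Fin n) × EuclideanSpace ℝ (Fin n)} (hp : p.1 ∈ φ.target)
    (hp2 : p.2 ≠ 0) (a b : EuclideanSpace ℝ (Fin n)) :
    fundamentalTensor F.toFun (φ.symm p.1) (dChartSymm φ p.1 p.2) (dChartSymm φ p.1 a)
        (dChartSymm φ p.1 b) =
      (1 / 2) * fderiv ℝ (fderiv ℝ fun q => coordF F.toFun φ q ^ 2) p (0, a) (0, b) := by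
  have h : ContDiffAt ℝ 2 (fun q => coordF F.toFun φ q ^ 2) p :=
    contDiffAt_infty.1 ((contDiffAt_coordF F hφ hp hp2).pow 2) _
  rw [← deriv_deriv_eq_fderiv_fderiv h, fundamentalTensor]
  have hq : ∀ s t : ℝ, p + s • ((0 : EuclideanSpace ℝ (Fin n)), a) +
      t • ((0 : EuclideanSpace ℝ (Fin n)), b) = (p.1, p.2 + s • a + t • b) := fun s t => by
    ext <;> simp
  simp only [hq]
  simp only [coordF, map_add, map_smul]

theorem differentiableAt_coordG (F : FinslerStructure n M)
    {φ : OpenPartialHomeomorph M (EuclideanSpace ℝ (Fin n))}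
    (hφ : φ ∈ IsManifold.maximalAtlas (𝓡 n) ∞ M)
    {p : EuclideanSpace ℝ (Fin n) × EuclideanSpace ℝ (Fin n)} (hp : p.1 ∈ φ.target)
    (hp2 : p.2 ≠ 0) (i j : Fin n) :
    DifferentiableAt ℝ (fun q => coordG F.toFun φ q i j) p := by
  have h : ContDiffAt ℝ 3 (fun q => coordF F.toFun φ q ^ 2) p :=
    contDiffAt_infty.1 ((contDiffAt_coordF F hφ hp hp2).pow 2) _
  have h' : DifferentiableAt ℝ (fderiv ℝ (fderiv ℝ fun q => coordF F.toFun φ q ^ 2)) p :=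
    ((h.fderiv_right (m := 2) (by norm_num)).fderiv_right (m := 1) (by norm_num)).differentiableAt
      (by simp)
  refine DifferentiableAt.congr_of_eventuallyEq (f := fun q => (1 / 2) *
    fderiv ℝ (fderiv ℝ fun q => coordF F.toFun φ q ^ 2) q (0, EuclideanSpace.single i 1)
      (0, EuclideanSpace.single j 1)) (by fun_prop) ?_
  filter_upwards [(isOpen_target_prod φ).mem_nhds ⟨hp, hp2⟩] with q hq
  exact fundamentalTensor_eq_fderiv F hφ hq.1 hq.2 _ _

/-! ### The inner products `g_{(x,y)}` -/

theorem exists_eq_symm_apply (x : M) : ∃ φ ∈ IsManifold.maximalAtlas (𝓡 n) ∞ M,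
    ∃ ξ ∈ φ.target, φ.symm ξ = x :=
  ⟨chartAt (EuclideanSpace ℝ (Fin n)) x, IsManifold.chart_mem_maximalAtlas x,
    chartAt _ x x, mem_chart_target _ x, (chartAt _ x).left_inv (mem_chart_source _ x)⟩

namespace FinslerStructure

variable (F : FinslerStructure n M) {x : M} {y : TangentSpace (𝓡 n) x}

theorem fundamentalTensor_symm (hy : y ≠ 0) (v w : TangentSpace (𝓡 n) x) :
    fundamentalTensor F.toFun x y v w = fundamentalTensor F.toFun x y w v := by
  obtain ⟨φ, hφ, ξ, hξ, rfl⟩ := exists_eq_symm_apply (n := n) x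
  obtain ⟨c, hc, rfl⟩ := exists_dChartSymm_eq hφ hξ hy
  obtain ⟨a, rfl⟩ := dChartSymm_surjective hφ hξ v
  obtain ⟨b, rfl⟩ := dChartSymm_surjective hφ hξ w
  have hs : IsSymmSndFDerivAt ℝ (fun q => coordF F.toFun φ q ^ 2) (ξ, c) :=
    (contDiffAt_infty.1 ((contDiffAt_coordF F hφ (p := (ξ, c)) hξ hc).pow 2) 2).isSymmSndFDerivAt
      (by simp)
  have h := fundamentalTensor_eq_fderiv F hφ (p := (ξ, c)) hξ hc
  exact (h a b).trans ((congrArg _ (hs.eq _ _)).trans (h b a).symm)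

theorem fundamentalTensor_add (hy : y ≠ 0) (v v' w : TangentSpace (𝓡 n) x) :
    fundamentalTensor F.toFun x y (v + v') w =
      fundamentalTensor F.toFun x y v w + fundamentalTensor F.toFun x y v' w := by
  obtain ⟨φ, hφ, ξ, hξ, rfl⟩ := exists_eq_symm_apply (n := n) x
  obtain ⟨c, hc, rfl⟩ := exists_dChartSymm_eq hφ hξ hy
  obtain ⟨a, rfl⟩ := dChartSymm_surjective hφ hξ v
  obtain ⟨a', rfl⟩ := dChartSymm_surjective hφ hξ v'
  obtain ⟨b, rfl⟩ := dChartSymm_surjective hφ hξ w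
  have h := fundamentalTensor_eq_fderiv F hφ (p := (ξ, c)) hξ hc
  have h0 : ((0 : EuclideanSpace ℝ (Fin n)), a + a') = (0, a) + (0, a') := by simp
  rw [← map_add]
  refine (h _ b).trans (Eq.trans ?_ (congrArg₂ (· + ·) (h a b) (h a' b)).symm)
  rw [h0, map_add, add_apply, mul_add]

theorem fundamentalTensor_smul (hy : y ≠ 0) (c : ℝ) (v w : TangentSpace (𝓡 n) x) :
    fundamentalTensor F.toFun x y (c • v) w = c * fundamentalTensor F.toFun x y v w := by
  obtain ⟨φ, hφ, ξ, hξ, rfl⟩ := exists_eq_symm_apply (n := n) x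
  obtain ⟨d, hd, rfl⟩ := exists_dChartSymm_eq hφ hξ hy
  obtain ⟨a, rfl⟩ := dChartSymm_surjective hφ hξ v
  obtain ⟨b, rfl⟩ := dChartSymm_surjective hφ hξ w
  have h := fundamentalTensor_eq_fderiv F hφ (p := (ξ, d)) hξ hd
  have h0 : ((0 : EuclideanSpace ℝ (Fin n)), c • a) = c • ((0 : EuclideanSpace ℝ (Fin n)), a) := by
    simp
  rw [← map_smul]
  refine (h _ b).trans (Eq.trans ?_ (congrArg (c * ·) (h a b)).symm)
  rw [h0, map_smul, smul_apply, smul_eq_mul, mul_left_comm]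

/-- The inner product `g_{(x,y)}` on the tangent space at `x`, as a bilinear form. -/
def metric (hy : y ≠ 0) : LinearMap.BilinForm ℝ (TangentSpace (𝓡 n) x) :=
  LinearMap.mk₂ ℝ (fundamentalTensor F.toFun x y) (F.fundamentalTensor_add hy)
    (F.fundamentalTensor_smul hy)
    (fun v w w' => by
      rw [F.fundamentalTensor_symm hy, F.fundamentalTensor_add hy, F.fundamentalTensor_symm hy w,
        F.fundamentalTensor_symm hy w'])
    (fun c v w => by
      rw [F.fundamentalTensor_symm hy, F.fundamentalTensor_smul hy, F.fundamentalTensor_symm hy w,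
        smul_eq_mul])

theorem metric_apply (hy : y ≠ 0) (v w : TangentSpace (𝓡 n) x) :
    F.metric hy v w = fundamentalTensor F.toFun x y v w := rfl

theorem metric_symm (hy : y ≠ 0) (v w : TangentSpace (𝓡 n) x) :
    F.metric hy v w = F.metric hy w v := F.fundamentalTensor_symm hy v w

theorem metric_pos (hy : y ≠ 0) {v : TangentSpace (𝓡 n) x} (hv : v ≠ 0) : 0 < F.metric hy v v :=
  F.posDef x y v hy hv

/-- Euler's relation `g_{(x,y)}(y,y) = F(x,y)²`. -/
theorem metric_self (hy : y ≠ 0) : F.metric hy y y = F.toFun ⟨x, y⟩ ^ 2 := by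
  rw [metric_apply, fundamentalTensor]
  have h1 : (fun s : ℝ => deriv (fun t : ℝ => F.toFun ⟨x, y + s • y + t • y⟩ ^ 2) 0) =ᶠ[𝓝 0]
      fun s => 2 * (1 + s) * F.toFun ⟨x, y⟩ ^ 2 := by
    filter_upwards [lt_mem_nhds (show (-1 : ℝ) < 0 by norm_num)] with s hs
    have h2 : (fun t : ℝ => F.toFun ⟨x, y + s • y + t • y⟩ ^ 2) =ᶠ[𝓝 0]
        fun t => (1 + s + t) ^ 2 * F.toFun ⟨x, y⟩ ^ 2 := by
      filter_upwards [lt_mem_nhds (show -(1 + s) < 0 by linarith)] with t ht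
      rw [show y + s • y + t • y = (1 + s + t) • y by module,
        F.homogeneous x y _ hy (by linarith), mul_pow]
    rw [h2.deriv_eq]
    have h3 : HasDerivAt (fun t : ℝ => (1 + s + t) ^ 2 * F.toFun ⟨x, y⟩ ^ 2)
        (2 * (1 + s + 0) ^ 1 * 1 * F.toFun ⟨x, y⟩ ^ 2) 0 := by
      have := (((hasDerivAt_id (0 : ℝ)).const_add (1 + s)).pow 2).mul_const (F.toFun ⟨x, y⟩ ^ 2)
      simpa using this
    rw [h3.deriv]
    ring
  rw [h1.deriv_eq]
  have h4 : HasDerivAt (fun s : ℝ => 2 * (1 + s) * F.toFun ⟨x, y⟩ ^ 2)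
      (2 * 1 * F.toFun ⟨x, y⟩ ^ 2) 0 :=
    (((hasDerivAt_id (0 : ℝ)).const_add 1).const_mul 2).mul_const _
  rw [h4.deriv]
  ring

theorem pos (hy : y ≠ 0) : 0 < F.toFun ⟨x, y⟩ :=
  (F.nonneg x y hy).lt_of_ne' fun h => by
    have := F.metric_pos hy hy
    rw [metric_self, h] at this
    simp at this

/-- The fundamental tensor is positively homogeneous of degree `0`. -/
theorem metric_pos_smul (hy : y ≠ 0) {c : ℝ} (hc : 0 < c) (hcy : c • y ≠ 0)
    (v w : TangentSpace (𝓡 n) x) : F.metric hcy v w = F.metric hy v w := by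
  have hc' := hc.ne'
  simp only [metric_apply, fundamentalTensor]
  congr 1
  let r : ℝ → ℝ → ℝ := fun s t => F.toFun ⟨x, y + s • v + t • w⟩ ^ 2
  let k : ℝ → ℝ := fun s => deriv (r s) 0
  have h1 : (fun s : ℝ => deriv (fun t : ℝ => F.toFun ⟨x, c • y + s • v + t • w⟩ ^ 2) 0) =ᶠ[𝓝 0]
      fun s => c * k (c⁻¹ * s) := by
    filter_upwards [eventually_add_smul_ne_zero hcy v] with s hs
    have h2 : (fun t : ℝ => F.toFun ⟨x, c • y + s • v + t • w⟩ ^ 2) =ᶠ[𝓝 0]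
        fun t => c ^ 2 * r (c⁻¹ * s) (c⁻¹ * t) := by
      filter_upwards [eventually_add_smul_ne_zero hs w] with t ht
      have h3 : c • y + s • v + t • w = c • (y + (c⁻¹ * s) • v + (c⁻¹ * t) • w) := by
        simp only [smul_add, smul_smul, mul_inv_cancel_left₀ hc']
      have h4 : y + (c⁻¹ * s) • v + (c⁻¹ * t) • w ≠ 0 := fun h => ht (by rw [h3, h, smul_zero])
      rw [h3, F.homogeneous x _ c h4 hc, mul_pow]
    rw [h2.deriv_eq, deriv_const_mul_field, deriv_comp_mul_left c⁻¹ (r (c⁻¹ * s)), mul_zero,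
      smul_eq_mul]
    field_simp
    rfl
  rw [h1.deriv_eq, deriv_const_mul_field, deriv_comp_mul_left c⁻¹ k, mul_zero, smul_eq_mul,
    mul_inv_cancel_left₀ hc']

end FinslerStructure
end Coordinates

/-! ### Bilinear forms with the same orthogonality -/

/-- Two inner products with the same orthogonal pairs are proportional: `v + c y` and `v - c y` are
orthogonal whenever `v` and `c y` have the same length. -/
theorem bilinForm_eq_mul_of_orthogonal {V : Type*} [AddCommGroup V] [Module ℝ V]
    {B B' : LinearMap.BilinForm ℝ V} (hs : ∀ v w, B v w = B w v) (hs' : ∀ v w, B' v w = B' w v)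
    (hpos : ∀ v, v ≠ 0 → 0 < B v v) (horth : ∀ v w, v ≠ 0 → w ≠ 0 → B v w = 0 → B' v w = 0)
    {y : V} (hy : y ≠ 0) (v w : V) : B' v w = B' y y / B y y * B v w := by
  have hyy := hpos y hy
  have horth' : ∀ v w, B v w = 0 → B' v w = 0 := by
    intro v w h
    by_cases hv : v = 0
    · simp [hv]
    by_cases hw : w = 0
    · simp [hw]
    exact horth v w hv hw h
  have hdiag : ∀ v, B' v v = B' y y / B y y * B v v := by
    intro v
    by_cases hv : v = 0
    · simp [hv]
    obtain ⟨c, hc⟩ : ∃ c : ℝ, c ^ 2 = B v v / B y y :=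
      ⟨√(B v v / B y y), Real.sq_sqrt (div_nonneg (hpos v hv).le hyy.le)⟩
    have h1 : B (v + c • y) (v - c • y) = 0 := by
      simp only [map_add, map_sub, map_smul, LinearMap.add_apply, LinearMap.smul_apply,
        smul_eq_mul, hs y v]
      have : c ^ 2 * B y y = B v v := by rw [hc]; field_simp
      linear_combination -this
    have h2 := horth' _ _ h1
    simp only [map_add, map_sub, map_smul, LinearMap.add_apply, LinearMap.smul_apply,
      smul_eq_mul, hs' y v] at h2
    rw [div_mul_eq_mul_div, mul_div_assoc, ← hc]
    linear_combination h2
  have h1 := hdiag (v + w)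
  simp only [map_add, LinearMap.add_apply, hs w v, hs' w v] at h1
  rw [mul_add, mul_add, mul_add] at h1
  linear_combination (1 / 2) * h1 - (1 / 2) * hdiag v - (1 / 2) * hdiag w

theorem bilinForm_map_eq_mul_of_orthogonal {V W : Type*} [AddCommGroup V] [Module ℝ V]
    [AddCommGroup W] [Module ℝ W] (e : V →ₗ[ℝ] W) {B : LinearMap.BilinForm ℝ V}
    {B' : LinearMap.BilinForm ℝ W} (hs : ∀ v w, B v w = B w v) (hs' : ∀ v w, B' v w = B' w v)
    (hpos : ∀ v, v ≠ 0 → 0 < B v v)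
    (horth : ∀ v w, v ≠ 0 → w ≠ 0 → B v w = 0 → B' (e v) (e w) = 0)
    {y : V} (hy : y ≠ 0) (v w : V) : B' (e v) (e w) = B' (e y) (e y) / B y y * B v w :=
  bilinForm_eq_mul_of_orthogonal (B' := B'.compl₁₂ e e) hs (fun _ _ => hs' _ _) hpos horth hy v w

theorem exists_forall_bilinForm_eq {V : Type*} [AddCommGroup V] [Module ℝ V]
    [FiniteDimensional ℝ V] (B : LinearMap.BilinForm ℝ V) (hpos : ∀ v, v ≠ 0 → 0 < B v v)
    (α : V →ₗ[ℝ] ℝ) : ∃ v, ∀ w, B v w = α w := by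
  have hinj : Function.Injective B := by
    rw [injective_iff_map_eq_zero]
    intro v hv
    by_contra h
    have := hpos v h
    simp [hv] at this
  have hsurj : Function.Surjective B :=
    (LinearMap.injective_iff_surjective_of_finrank_eq_finrank
      (Subspace.dual_finrank_eq (K := ℝ) (V := V)).symm).1 hinj
  obtain ⟨v, hv⟩ := hsurj α
  exact ⟨v, fun w => by rw [hv]⟩

/-! ### The norm of the gradient of a vertical lift -/

section Gradient

variable {n : ℕ} {M : Type*} [TopologicalSpace M] [ChartedSpace (EuclideanSpace ℝ (Fin n)) M]

/-- For a differential `θ` which vanishes on vertical vectors the gradient is the horizontal lift of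
the vector `a` that represents `θ` for `g_{ij}`; hence its length is that of `a`. -/
theorem sasaki_gradient_self (F : TangentBundle (𝓡 n) M → ℝ)
    (φ : OpenPartialHomeomorph M (EuclideanSpace ℝ (Fin n)))
    (p : EuclideanSpace ℝ (Fin n) × EuclideanSpace ℝ (Fin n))
    (hG : ∀ i j, coordG F φ p i j = coordG F φ p j i)
    (θ : EuclideanSpace ℝ (Fin n) →L[ℝ] ℝ) (a : EuclideanSpace ℝ (Fin n))
    (ha : ∀ w : EuclideanSpace ℝ (Fin n), ∑ i, ∑ j, coordG F φ p i j * a i * w j = θ w) :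
    sasaki F φ p (gradient F φ p (θ.comp (ContinuousLinearMap.fst ℝ _ _)))
      (gradient F φ p (θ.comp (ContinuousLinearMap.fst ℝ _ _))) = θ a := by
  have hsymm : ∀ Z W, sasaki F φ p Z W = sasaki F φ p W Z := by
    intro Z W
    unfold sasaki
    congr 1
    · rw [Finset.sum_comm]
      refine Finset.sum_congr rfl fun i _ => Finset.sum_congr rfl fun j _ => ?_
      rw [hG j i]; ring
    · rw [Finset.sum_comm]
      refine Finset.sum_congr rfl fun i _ => Finset.sum_congr rfl fun j _ => ?_
      rw [hG j i]; ring
  let Z₀ : EuclideanSpace ℝ (Fin n) × EuclideanSpace ℝ (Fin n) :=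
    (a, WithLp.toLp 2 fun i => -∑ j, connectionCoeff F φ i j p * a j)
  have hδ : ∀ i, deltaY F φ p Z₀ i = 0 := fun i => by simp [deltaY, Z₀]
  have hZ₀ : ∀ W, sasaki F φ p Z₀ W = θ.comp (ContinuousLinearMap.fst ℝ _ _) W := by
    intro W
    simp only [sasaki, hδ, zero_div, mul_zero, zero_mul, Finset.sum_const_zero, add_zero]
    exact ha W.1
  have hZ := Classical.epsilon_spec (p := fun Z => ∀ W, sasaki F φ p Z W =
    θ.comp (ContinuousLinearMap.fst ℝ _ _) W) ⟨Z₀, hZ₀⟩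
  change ∀ W, sasaki F φ p (gradient F φ p (θ.comp (ContinuousLinearMap.fst ℝ _ _))) W = _ at hZ
  rw [hZ, ← hZ₀, hsymm, hZ]
  rfl

variable [IsManifold (𝓡 n) ∞ M]

theorem sum_coordG_mul (F : FinslerStructure n M)
    {φ : OpenPartialHomeomorph M (EuclideanSpace ℝ (Fin n))}
    {p : EuclideanSpace ℝ (Fin n) × EuclideanSpace ℝ (Fin n)} (hp : dChartSymm φ p.1 p.2 ≠ 0)
    (a b : EuclideanSpace ℝ (Fin n)) :
    ∑ i, ∑ j, coordG F.toFun φ p i j * a i * b j =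
      F.metric hp (dChartSymm φ p.1 a) (dChartSymm φ p.1 b) := by
  have h : ∀ a : EuclideanSpace ℝ (Fin n), dChartSymm φ p.1 a =
      ∑ i, a i • dChartSymm φ p.1 (EuclideanSpace.single i 1) := by
    intro a
    have ha : a = ∑ i, a i • EuclideanSpace.single i (1 : ℝ) := by
      ext j
      simp [Finset.sum_apply, Pi.single_apply]
    conv_lhs => rw [ha]
    simp [map_sum]
  rw [h a, h b]
  simp only [map_sum, LinearMap.sum_apply, map_smul, LinearMap.smul_apply, smul_eq_mul]
  rw [Finset.sum_comm]
  refine Finset.sum_congr rfl fun i _ => ?_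
  rw [Finset.mul_sum]
  refine Finset.sum_congr rfl fun j _ => ?_
  rw [FinslerStructure.metric_apply]
  simp only [coordG, Matrix.of_apply]
  ring

theorem coordG_symm (F : FinslerStructure n M)
    {φ : OpenPartialHomeomorph M (EuclideanSpace ℝ (Fin n))}
    {p : EuclideanSpace ℝ (Fin n) × EuclideanSpace ℝ (Fin n)} (hp : dChartSymm φ p.1 p.2 ≠ 0)
    (i j : Fin n) : coordG F.toFun φ p i j = coordG F.toFun φ p j i :=
  F.fundamentalTensor_symm hp _ _

/-- The norm of the gradient of the vertical lift at `(x, [y])` is the norm for `g_{(x,y)}` of the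
vector `v` which represents the differential `α` for `g_{(x,y)}`. -/
theorem normGradLift_eq (F : FinslerStructure n M)
    (α : ∀ x : M, TangentSpace (𝓡 n) x →L[ℝ] ℝ) (z : SphereBundle n M)
    {y : TangentSpace (𝓡 n) z.pt} (hy : y ≠ 0) (hz : z.ray = rayOfNeZero ℝ y hy)
    (v : TangentSpace (𝓡 n) z.pt) (hv : ∀ w, F.metric hy v w = α z.pt w) :
    normGradLift F.toFun α z = √(F.metric hy v v) := by
  obtain ⟨x, ray⟩ := z
  dsimp only at y hy hz v hv
  -- the representative chosen in the definition is a positive multiple of `y`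
  have hsame : SameRay ℝ y ray.someVector := by
    rw [← ray_eq_iff hy ray.someVector_ne_zero, Module.Ray.someVector_ray, hz]
  obtain ⟨c, hc, hcy⟩ := hsame.exists_pos_left hy ray.someVector_ne_zero
  have hy₀ : c • y ≠ 0 := hcy ▸ ray.someVector_ne_zero
  have hv' : ∀ w, F.metric hy₀ v w = α x w := fun w =>
    (F.metric_pos_smul hy hc hy₀ v w).trans (hv w)
  rw [← F.metric_pos_smul hy hc hy₀ v v, hv']
  have hφ := IsManifold.chart_mem_maximalAtlas (I := 𝓡 n) (n := ∞) x
  have hx := mem_chart_source (EuclideanSpace ℝ (Fin n)) x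
  simp only [normGradLift, ← hcy]
  congr 1
  generalize chartAt (EuclideanSpace ℝ (Fin n)) x = φ at hφ hx
  -- the inverse chart undoes the chart on the level of points and of tangent vectors
  have hpt : φ.symm (φ x) = x := φ.left_inv hx
  have hD : ∀ w : TangentSpace (𝓡 n) x,
      (dChartSymm φ (φ x) (mfderiv (𝓡 n) (𝓡 n) φ x w) : EuclideanSpace ℝ (Fin n)) = w := by
    intro w
    have h := (mdifferentiable_of_mem_maximalAtlas hφ).symm_comp_deriv hx
    exact congrArg (fun L : TangentSpace (𝓡 n) x →L[ℝ] TangentSpace (𝓡 n) x => L w) h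
  have htrans : ∀ x', x' = x → ∀ a b c : EuclideanSpace ℝ (Fin n),
      fundamentalTensor F.toFun x' a b c = fundamentalTensor F.toFun x a b c := by
    rintro _ rfl _ _ _; rfl
  have hα : ∀ x', x' = x → ∀ a : EuclideanSpace ℝ (Fin n), α x' a = α x a := by
    rintro _ rfl _; rfl
  have hp : dChartSymm φ (φ x) (mfderiv (𝓡 n) (𝓡 n) φ x (c • y)) ≠ 0 :=
    fun h => hy₀ ((hD _).symm.trans h)
  have hval : ∀ w : EuclideanSpace ℝ (Fin n),
      F.metric hp (dChartSymm φ (φ x) (mfderiv (𝓡 n) (𝓡 n) φ x v)) (dChartSymm φ (φ x) w) =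
        α (φ.symm (φ x)) (dChartSymm φ (φ x) w) := by
    intro w
    refine Eq.trans ?_ (Eq.trans (hv' (dChartSymm φ (φ x) w : EuclideanSpace ℝ (Fin n)))
      (hα _ hpt _).symm)
    exact (htrans _ hpt _ _ _).trans (congrArg₂
      (fun a b : EuclideanSpace ℝ (Fin n) => fundamentalTensor F.toFun x a b (dChartSymm φ (φ x) w))
      (hD (c • y)) (hD v))
  refine (sasaki_gradient_self F.toFun φ (φ x, mfderiv (𝓡 n) (𝓡 n) φ x (c • y))
    (coordG_symm F hp) ((α (φ.symm (φ x))).comp (dChartSymm φ (φ x)))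
    (mfderiv (𝓡 n) (𝓡 n) φ x v) fun w => ?_).trans ?_
  · exact (sum_coordG_mul F (p := (φ x, mfderiv (𝓡 n) (𝓡 n) φ x (c • y))) hp _ w).trans (hval w)
  · exact (hα _ hpt _).trans (congrArg (fun w : EuclideanSpace ℝ (Fin n) => α x w) (hD v))

end Gradient

section Transport

variable {n : ℕ} {M : Type*} [TopologicalSpace M] [ChartedSpace (EuclideanSpace ℝ (Fin n)) M]
  {M' : Type*} [TopologicalSpace M'] [ChartedSpace (EuclideanSpace ℝ (Fin n)) M']

/-! ### The map of sphere bundles induced by a diffeomorphism -/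

/-- The differential of a diffeomorphism at a point, as a linear equivalence. -/
def tangentEquiv (f : M ≃ₘ^∞⟮𝓡 n, 𝓡 n⟯ M') (x : M) :
    TangentSpace (𝓡 n) x ≃L[ℝ] TangentSpace (𝓡 n) (f x) :=
  f.mfderivToContinuousLinearEquiv (by simp) x

theorem tangentEquiv_ne_zero (f : M ≃ₘ^∞⟮𝓡 n, 𝓡 n⟯ M') {x : M} {v : TangentSpace (𝓡 n) x}
    (hv : v ≠ 0) : tangentEquiv f x v ≠ 0 :=
  (tangentEquiv f x).map_ne_zero_iff.2 hv

theorem tangentMap_symm_tangentMap (f : M ≃ₘ^∞⟮𝓡 n, 𝓡 n⟯ M') (p : TangentBundle (𝓡 n) M) :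
    tangentMap (𝓡 n) (𝓡 n) f.symm (tangentMap (𝓡 n) (𝓡 n) f p) = p := by
  have h := tangentMap_comp_at (I := 𝓡 n) (I' := 𝓡 n) (I'' := 𝓡 n) (f := f) (g := f.symm) p
    (f.symm.mdifferentiable (by simp) _) (f.mdifferentiable (by simp) _)
  rw [← h, show f.symm ∘ f = id from funext f.symm_apply_apply, tangentMap_id, id]

/-- The map `(x, [y]) ↦ (f x, [f_* y])` of sphere bundles. -/
def sphereMap (f : M ≃ₘ^∞⟮𝓡 n, 𝓡 n⟯ M') (z : SphereBundle n M) : SphereBundle n M' :=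
  ⟨f z.pt, z.ray.map (tangentEquiv f z.pt).toLinearEquiv⟩

/-- The tangent map of a diffeomorphism, restricted to the slit tangent bundles. -/
def slitTangentMap (f : M ≃ₘ^∞⟮𝓡 n, 𝓡 n⟯ M') (p : {p : TangentBundle (𝓡 n) M // p.2 ≠ 0}) :
    {p : TangentBundle (𝓡 n) M' // p.2 ≠ 0} :=
  ⟨tangentMap (𝓡 n) (𝓡 n) f p.1, tangentEquiv_ne_zero f p.2⟩

theorem sphereMap_toSphereBundle (f : M ≃ₘ^∞⟮𝓡 n, 𝓡 n⟯ M')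
    (p : {p : TangentBundle (𝓡 n) M // p.2 ≠ 0}) :
    sphereMap f (toSphereBundle p) = toSphereBundle (slitTangentMap f p) := by
  simp only [sphereMap, toSphereBundle]
  rfl

theorem toSphereBundle_surjective :
    Function.Surjective (toSphereBundle : {p : TangentBundle (𝓡 n) M // p.2 ≠ 0} → _) := by
  rintro ⟨x, r⟩
  refine ⟨⟨⟨x, r.someVector⟩, r.someVector_ne_zero⟩, ?_⟩
  simp only [toSphereBundle, Module.Ray.someVector_ray]

theorem sphereMap_symm_sphereMap (f : M ≃ₘ^∞⟮𝓡 n, 𝓡 n⟯ M') (z : SphereBundle n M) :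
    sphereMap f.symm (sphereMap f z) = z := by
  obtain ⟨p, rfl⟩ := toSphereBundle_surjective z
  rw [sphereMap_toSphereBundle, sphereMap_toSphereBundle]
  congr 1
  exact Subtype.ext (tangentMap_symm_tangentMap f p.1)

theorem sphereMap_sphereMap_symm (f : M ≃ₘ^∞⟮𝓡 n, 𝓡 n⟯ M') (z : SphereBundle n M') :
    sphereMap f (sphereMap f.symm z) = z :=
  sphereMap_symm_sphereMap f.symm z

variable [IsManifold (𝓡 n) ∞ M] [IsManifold (𝓡 n) ∞ M']

theorem continuous_sphereMap (f : M ≃ₘ^∞⟮𝓡 n, 𝓡 n⟯ M') : Continuous (sphereMap f) := by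
  refine continuous_coinduced_dom.2 ?_
  have h : sphereMap f ∘ toSphereBundle = toSphereBundle ∘ slitTangentMap f :=
    funext (sphereMap_toSphereBundle f)
  rw [h]
  refine continuous_coinduced_rng.comp (Continuous.subtype_mk ?_ _)
  exact (f.contMDiff.continuous_tangentMap (by simp)).comp continuous_subtype_val

/-- The homeomorphism of sphere bundles induced by a diffeomorphism. -/
def sphereHomeomorph (f : M ≃ₘ^∞⟮𝓡 n, 𝓡 n⟯ M') : SphereBundle n M ≃ₜ SphereBundle n M' where
  toFun := sphereMap f
  invFun := sphereMap f.symm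
  left_inv := sphereMap_symm_sphereMap f
  right_inv := sphereMap_sphereMap_symm f
  continuous_toFun := continuous_sphereMap f
  continuous_invFun := continuous_sphereMap f.symm

instance sphereBundleBorel : BorelSpace (SphereBundle n M) := ⟨rfl⟩

/-! ### The conformal factor -/

variable (F : FinslerStructure n M) (F' : FinslerStructure n M') {f : M ≃ₘ^∞⟮𝓡 n, 𝓡 n⟯ M'}

/-- The ratio `F'(f x, f_* y) / F(x, y)`. -/
def dilation (f : M ≃ₘ^∞⟮𝓡 n, 𝓡 n⟯ M') (p : TangentBundle (𝓡 n) M) : ℝ :=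
  F'.toFun (tangentMap (𝓡 n) (𝓡 n) f p) / F.toFun p

theorem dilation_pos {p : TangentBundle (𝓡 n) M} (hp : p.2 ≠ 0) : 0 < dilation F F' f p :=
  div_pos (F'.pos (y := tangentEquiv f p.1 p.2) (tangentEquiv_ne_zero f hp)) (F.pos hp)

theorem dilation_pos_smul {x : M} {y : TangentSpace (𝓡 n) x} (hy : y ≠ 0) {c : ℝ} (hc : 0 < c) :
    dilation F F' f ⟨x, c • y⟩ = dilation F F' f ⟨x, y⟩ := by
  have h : F'.toFun (tangentMap (𝓡 n) (𝓡 n) f ⟨x, c • y⟩) =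
      c * F'.toFun (tangentMap (𝓡 n) (𝓡 n) f ⟨x, y⟩) := by
    have e := F'.homogeneous (f x) (tangentEquiv f x y) c (tangentEquiv_ne_zero f hy) hc
    rw [← map_smul] at e
    exact e
  rw [dilation, dilation, h, F.homogeneous x y c hy hc, mul_div_mul_left _ _ hc.ne']

theorem continuousOn_dilation : ContinuousOn (dilation F F' f) {p | p.2 ≠ 0} :=
  (F'.smooth.continuousOn.comp (f.contMDiff.continuous_tangentMap (by simp)).continuousOn
    fun _ hp => tangentEquiv_ne_zero f hp).div F.smooth.continuousOn fun _ hp => (F.pos hp).ne'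

/-- The dilation as a function on the sphere bundle. -/
def sphereDilation (f : M ≃ₘ^∞⟮𝓡 n, 𝓡 n⟯ M') (z : SphereBundle n M) : ℝ :=
  dilation F F' f ⟨z.pt, z.ray.someVector⟩

theorem sphereDilation_mk {x : M} {y : TangentSpace (𝓡 n) x} (hy : y ≠ 0) :
    sphereDilation F F' f ⟨x, rayOfNeZero ℝ y hy⟩ = dilation F F' f ⟨x, y⟩ := by
  have hsame : SameRay ℝ y (rayOfNeZero ℝ y hy).someVector := by
    rw [← ray_eq_iff hy (Module.Ray.someVector_ne_zero _), Module.Ray.someVector_ray]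
  obtain ⟨c, hc, hcy⟩ := hsame.exists_pos_left hy (Module.Ray.someVector_ne_zero _)
  rw [sphereDilation, ← hcy, dilation_pos_smul F F' hy hc]

theorem sphereDilation_pos (z : SphereBundle n M) : 0 < sphereDilation F F' f z :=
  dilation_pos F F' z.ray.someVector_ne_zero

theorem continuous_sphereDilation : Continuous (sphereDilation F F' f) := by
  refine continuous_coinduced_dom.2 ?_
  have h : sphereDilation F F' f ∘ toSphereBundle = fun p => dilation F F' f p.1 :=
    funext fun p => sphereDilation_mk F F' p.2
  rw [h]
  exact continuousOn_iff_continuous_domRestrict.1 (continuousOn_dilation F F')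

variable {F F'}

/-- A conformal map multiplies the inner products `g_{(x,y)}` by the square of the dilation at
`(x, y)`. -/
theorem IsConformal.metric_eq (hf : IsConformal F F' f) {x : M} {y : TangentSpace (𝓡 n) x}
    (hy : y ≠ 0) (v w : TangentSpace (𝓡 n) x) :
    F'.metric (tangentEquiv_ne_zero f hy) (tangentEquiv f x v) (tangentEquiv f x w) =
      dilation F F' f ⟨x, y⟩ ^ 2 * F.metric hy v w := by
  have hy' := tangentEquiv_ne_zero f hy
  have horth : ∀ v w, v ≠ 0 → w ≠ 0 → F.metric hy v w = 0 →
      F'.metric hy' (tangentEquiv f x v) (tangentEquiv f x w) = 0 := by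
    intro v w hv hw h
    have hangle := hf x y v w hy hv hw
    have h0 : angle F.toFun x y v w = Real.pi / 2 := by
      rw [angle, ← FinslerStructure.metric_apply F hy v w, h, zero_div, Real.arccos_zero]
    rw [h0, angle, Real.arccos_eq_pi_div_two, div_eq_zero_iff] at hangle
    refine hangle.resolve_right ?_
    have p1 := F'.metric_pos hy' (tangentEquiv_ne_zero f hv)
    have p2 := F'.metric_pos hy' (tangentEquiv_ne_zero f hw)
    exact (mul_pos (Real.sqrt_pos.2 p1) (Real.sqrt_pos.2 p2)).ne'
  have h := bilinForm_map_eq_mul_of_orthogonal (tangentEquiv f x).toLinearMap (F.metric_symm hy)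
    (F'.metric_symm hy') (fun v => F.metric_pos hy) horth hy v w
  have e1 : F'.metric hy' (tangentEquiv f x y) (tangentEquiv f x y) =
      F'.toFun (tangentMap (𝓡 n) (𝓡 n) f ⟨x, y⟩) ^ 2 := F'.metric_self hy'
  refine h.trans ?_
  rw [dilation, div_pow, ← e1, ← F.metric_self hy]
  rfl

theorem IsConformal.symm (hf : IsConformal F F' f) : IsConformal F' F f.symm := by
  intro x' y' v' w' hy' hv' hw'
  obtain ⟨x, rfl⟩ : ∃ x, f x = x' := ⟨f.symm x', f.apply_symm_apply x'⟩
  obtain ⟨y, rfl⟩ := (tangentEquiv f x).surjective y'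
  obtain ⟨v, rfl⟩ := (tangentEquiv f x).surjective v'
  obtain ⟨w, rfl⟩ := (tangentEquiv f x).surjective w'
  have hinv : ∀ a : TangentSpace (𝓡 n) x, (mfderiv (𝓡 n) (𝓡 n) f.symm (f x)
      (tangentEquiv f x a) : EuclideanSpace ℝ (Fin n)) = a := by
    intro a
    have h := tangentMap_symm_tangentMap f ⟨x, a⟩
    rw [Bundle.TotalSpace.ext_iff] at h
    exact eq_of_heq h.2
  have htrans : ∀ x₁, x₁ = x → ∀ a b c : EuclideanSpace ℝ (Fin n),
      angle F.toFun x₁ a b c = angle F.toFun x a b c := by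
    rintro _ rfl _ _ _; rfl
  refine (htrans _ (f.symm_apply_apply x) _ _ _).trans ?_
  refine (congr (congr (congrArg (fun a b c : EuclideanSpace ℝ (Fin n) => angle F.toFun x a b c)
    (hinv y)) (hinv v)) (hinv w)).trans ?_
  have hne : ∀ {a : TangentSpace (𝓡 n) x}, tangentEquiv f x a ≠ 0 → a ≠ 0 := fun h h0 =>
    h (by rw [h0, map_zero])
  exact (hf x y v w (hne hy') (hne hv') (hne hw')).symm

/-- The norms of gradients of vertical lifts are divided by the dilation. -/
theorem IsConformal.normGradLift_mul (hf : IsConformal F F' f)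
    (α' : ∀ x : M', TangentSpace (𝓡 n) x →L[ℝ] ℝ) (z : SphereBundle n M) :
    sphereDilation F F' f z * normGradLift F'.toFun α' (sphereMap f z) =
      normGradLift F.toFun
        (fun x => (α' (f x)).comp (mfderiv (𝓡 n) (𝓡 n) f x)) z := by
  obtain ⟨x, r⟩ := z
  have hy := r.someVector_ne_zero
  have hy' := tangentEquiv_ne_zero f hy
  have hs := sphereDilation_pos F F' (f := f) ⟨x, r⟩
  set s := sphereDilation F F' f ⟨x, r⟩ with hs_def
  have hm : ∀ v w, F'.metric hy' (tangentEquiv f x v) (tangentEquiv f x w) =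
      s ^ 2 * F.metric hy v w := hf.metric_eq hy
  have : FiniteDimensional ℝ (TangentSpace (𝓡 n) x) :=
    inferInstanceAs (FiniteDimensional ℝ (EuclideanSpace ℝ (Fin n)))
  obtain ⟨v, hv⟩ := exists_forall_bilinForm_eq (F.metric hy) (fun v => F.metric_pos hy)
    ((α' (f x)).comp (mfderiv (𝓡 n) (𝓡 n) f x)).toLinearMap
  have hray : (⟨x, r⟩ : SphereBundle n M).ray = rayOfNeZero ℝ _ hy := r.someVector_ray.symm
  have hray' : (sphereMap f ⟨x, r⟩).ray = rayOfNeZero ℝ _ hy' := by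
    have h : r.map (tangentEquiv f x).toLinearEquiv = rayOfNeZero ℝ _ hy' := by
      conv_lhs => rw [← r.someVector_ray]
      rw [Module.Ray.map_apply]
      rfl
    exact h
  -- the vector representing `α'` is `s⁻² f_* v`
  have hv' : ∀ w', F'.metric hy' (tangentEquiv f x ((s ^ 2)⁻¹ • v)) w' = α' (f x) w' := by
    intro w'
    obtain ⟨w, rfl⟩ := (tangentEquiv f x).surjective w'
    rw [hm, map_smul, LinearMap.smul_apply, smul_eq_mul, mul_inv_cancel_left₀ (by positivity), hv]
    rfl
  have e1 := (normGradLift_eq F' α' (sphereMap f ⟨x, r⟩) hy' hray' _ hv').trans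
    (congrArg Real.sqrt (hm _ _))
  rw [normGradLift_eq F _ ⟨x, r⟩ hy hray v hv, e1, map_smul, map_smul,
    LinearMap.smul_apply, smul_eq_mul, smul_eq_mul, mul_inv_cancel_left₀ (by positivity),
    Real.sqrt_mul (by positivity), Real.sqrt_inv, Real.sqrt_sq hs.le,
    mul_inv_cancel_left₀ hs.ne']

end Transport

section Volume

variable {n : ℕ} {M : Type*} [TopologicalSpace M] [ChartedSpace (EuclideanSpace ℝ (Fin n)) M]
  {M' : Type*} [TopologicalSpace M'] [ChartedSpace (EuclideanSpace ℝ (Fin n)) M']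

/-! ### Transport of charts -/

/-- The chart `φ ∘ f⁻¹` of `M'` obtained from a chart `φ` of `M`. -/
def transportChart (f : M ≃ₘ^∞⟮𝓡 n, 𝓡 n⟯ M')
    (φ : OpenPartialHomeomorph M (EuclideanSpace ℝ (Fin n))) :
    OpenPartialHomeomorph M' (EuclideanSpace ℝ (Fin n)) :=
  f.symm.toHomeomorph.transOpenPartialHomeomorph φ

theorem dChartSymm_transportChart (f : M ≃ₘ^∞⟮𝓡 n, 𝓡 n⟯ M')
    {φ : OpenPartialHomeomorph M (EuclideanSpace ℝ (Fin n))}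
    (hφ : φ ∈ IsManifold.maximalAtlas (𝓡 n) ∞ M) {ξ : EuclideanSpace ℝ (Fin n)}
    (hξ : ξ ∈ φ.target) (v : EuclideanSpace ℝ (Fin n)) :
    dChartSymm (transportChart f φ) ξ v = tangentEquiv f (φ.symm ξ) (dChartSymm φ ξ v) := by
  have h := mfderiv_comp (I := 𝓡 n) (I' := 𝓡 n) (I'' := 𝓡 n) (f := φ.symm) (g := f) ξ
    (f.mdifferentiable (by simp) _)
    ((mdifferentiable_of_mem_maximalAtlas hφ).symm.mdifferentiableAt hξ)
  exact congrArg (fun L : EuclideanSpace ℝ (Fin n) →L[ℝ] EuclideanSpace ℝ (Fin n) => L v) h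

theorem transportChart_mem_maximalAtlas (f : M ≃ₘ^∞⟮𝓡 n, 𝓡 n⟯ M')
    [IsManifold (𝓡 n) ∞ M'] {φ : OpenPartialHomeomorph M (EuclideanSpace ℝ (Fin n))}
    (hφ : φ ∈ IsManifold.maximalAtlas (𝓡 n) ∞ M) :
    transportChart f φ ∈ IsManifold.maximalAtlas (𝓡 n) ∞ M' :=
  (transportChart f φ).mem_maximalAtlas_of_contMDiffOn
    ((contMDiffOn_of_mem_maximalAtlas hφ).comp f.symm.contMDiff.contMDiffOn fun _ h => h)
    (f.contMDiff.comp_contMDiffOn (contMDiffOn_symm_of_mem_maximalAtlas hφ))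

/-! ### The volume element under a conformal map -/

variable [IsManifold (𝓡 n) ∞ M] [IsManifold (𝓡 n) ∞ M']

variable {F : FinslerStructure n M} {F' : FinslerStructure n M'} {f : M ≃ₘ^∞⟮𝓡 n, 𝓡 n⟯ M'}
  {φ : OpenPartialHomeomorph M (EuclideanSpace ℝ (Fin n))}
  {p : EuclideanSpace ℝ (Fin n) × EuclideanSpace ℝ (Fin n)}

theorem coordF_transportChart (hφ : φ ∈ IsManifold.maximalAtlas (𝓡 n) ∞ M)
    (hp : p.1 ∈ φ.target) (hp2 : p.2 ≠ 0) :
    coordF F'.toFun (transportChart f φ) p =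
      dilation F F' f ⟨φ.symm p.1, dChartSymm φ p.1 p.2⟩ * coordF F.toFun φ p := by
  have h : coordF F'.toFun (transportChart f φ) p =
      F'.toFun (tangentMap (𝓡 n) (𝓡 n) f ⟨φ.symm p.1, dChartSymm φ p.1 p.2⟩) := by
    rw [coordF, dChartSymm_transportChart f hφ hp]
    rfl
  rw [h, dilation]
  exact (div_mul_cancel₀ _ (F.pos (dChartSymm_ne_zero hφ hp hp2)).ne').symm

theorem IsConformal.coordG_transportChart (hf : IsConformal F F' f)
    (hφ : φ ∈ IsManifold.maximalAtlas (𝓡 n) ∞ M) (hp : p.1 ∈ φ.target) (hp2 : p.2 ≠ 0)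
    (i j : Fin n) :
    coordG F'.toFun (transportChart f φ) p i j =
      dilation F F' f ⟨φ.symm p.1, dChartSymm φ p.1 p.2⟩ ^ 2 * coordG F.toFun φ p i j := by
  have h := hf.metric_eq (dChartSymm_ne_zero hφ hp hp2)
    (dChartSymm φ p.1 (EuclideanSpace.single i 1)) (dChartSymm φ p.1 (EuclideanSpace.single j 1))
  rw [FinslerStructure.metric_apply, ← dChartSymm_transportChart f hφ hp,
    ← dChartSymm_transportChart f hφ hp, ← dChartSymm_transportChart f hφ hp] at h
  exact h

theorem IsConformal.hilbertForm_transportChart (hf : IsConformal F F' f)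
    (hφ : φ ∈ IsManifold.maximalAtlas (𝓡 n) ∞ M) (hp : p.1 ∈ φ.target) (hp2 : p.2 ≠ 0) :
    hilbertForm F'.toFun (transportChart f φ) p =
      (coordF F'.toFun (transportChart f φ) p / coordF F.toFun φ p) •
        hilbertForm F.toFun φ p := by
  have hF : 0 < coordF F.toFun φ p := F.pos (dChartSymm_ne_zero hφ hp hp2)
  have hd := dilation_pos F F' (f := f) (p := ⟨φ.symm p.1, dChartSymm φ p.1 p.2⟩)
    (dChartSymm_ne_zero hφ hp hp2)
  simp only [hilbertForm, hf.coordG_transportChart hφ hp hp2,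
    coordF_transportChart (F := F) hφ hp hp2]
  rw [Finset.smul_sum]
  refine Finset.sum_congr rfl fun i _ => ?_
  rw [smul_smul, Finset.mul_sum]
  congr 1
  refine Finset.sum_congr rfl fun j _ => ?_
  field_simp

theorem differentiableAt_hilbertForm (F : FinslerStructure n M)
    (hφ : φ ∈ IsManifold.maximalAtlas (𝓡 n) ∞ M) (hp : p.1 ∈ φ.target) (hp2 : p.2 ≠ 0) :
    DifferentiableAt ℝ (hilbertForm F.toFun φ) p := by
  have hF : coordF F.toFun φ p ≠ 0 := (F.pos (dChartSymm_ne_zero hφ hp hp2)).ne'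
  have hd := (contDiffAt_coordF F hφ hp hp2).differentiableAt (by simp)
  have hG := differentiableAt_coordG F hφ hp hp2
  unfold hilbertForm
  have hy : ∀ j : Fin n, DifferentiableAt ℝ
      (fun q : EuclideanSpace ℝ (Fin n) × EuclideanSpace ℝ (Fin n) => q.2 j) p := fun j =>
    ((EuclideanSpace.proj j).comp (ContinuousLinearMap.snd ℝ (EuclideanSpace ℝ (Fin n))
      (EuclideanSpace ℝ (Fin n)))).differentiableAt
  refine DifferentiableAt.fun_sum fun i _ => DifferentiableAt.smul_const ?_ _
  exact DifferentiableAt.fun_sum fun j _ => (hG i j).mul ((hy j).mul (hd.inv hF))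

/-- The volume form is multiplied by the `n`-th power of the dilation: `ω` is multiplied by a
function `s`, and the term `ds ∧ ω` of `d(s ω)` does not contribute. -/
theorem IsConformal.volumeForm_transportChart (hn : 1 ≤ n) (hf : IsConformal F F' f)
    (hφ : φ ∈ IsManifold.maximalAtlas (𝓡 n) ∞ M) (hp : p.1 ∈ φ.target) (hp2 : p.2 ≠ 0)
    (Z : Fin (2 * (n - 1) + 1) → EuclideanSpace ℝ (Fin n) × EuclideanSpace ℝ (Fin n)) :
    volumeForm F'.toFun (transportChart f φ) p Z =
      dilation F F' f ⟨φ.symm p.1, dChartSymm φ p.1 p.2⟩ ^ n * volumeForm F.toFun φ p Z := by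
  have hF : coordF F.toFun φ p ≠ 0 := (F.pos (dChartSymm_ne_zero hφ hp hp2)).ne'
  have hs : DifferentiableAt ℝ
      (fun q => coordF F'.toFun (transportChart f φ) q / coordF F.toFun φ q) p :=
    ((contDiffAt_coordF F' (transportChart_mem_maximalAtlas f hφ) hp hp2).differentiableAt
      (by simp)).mul (((contDiffAt_coordF F hφ hp hp2).differentiableAt (by simp)).inv hF)
  have hs_eq : coordF F'.toFun (transportChart f φ) p / coordF F.toFun φ p =
      dilation F F' f ⟨φ.symm p.1, dChartSymm φ p.1 p.2⟩ := by
    rw [coordF_transportChart hφ hp hp2, mul_div_cancel_right₀ _ hF]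
  have hev : (fun q => ContinuousAlternatingMap.ofSubsingleton ℝ
        (EuclideanSpace ℝ (Fin n) × EuclideanSpace ℝ (Fin n)) ℝ (0 : Fin 1)
        (hilbertForm F'.toFun (transportChart f φ) q)) =ᶠ[𝓝 p]
      fun q => ContinuousAlternatingMap.ofSubsingleton ℝ
        (EuclideanSpace ℝ (Fin n) × EuclideanSpace ℝ (Fin n)) ℝ (0 : Fin 1)
        ((coordF F'.toFun (transportChart f φ) q / coordF F.toFun φ q) •
          hilbertForm F.toFun φ q) := by
    filter_upwards [(isOpen_target_prod φ).mem_nhds ⟨hp, hp2⟩] with q hq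
    rw [hf.hilbertForm_transportChart hφ hq.1 hq.2]
  have hw := wedgePow_smul (n - 1) (dilation F F' f ⟨φ.symm p.1, dChartSymm φ p.1 p.2⟩)
    (hilbertForm F.toFun φ p) (hilbertForm F'.toFun (transportChart f φ) p)
    (dHilbertForm F.toFun φ p) (dHilbertForm F'.toFun (transportChart f φ) p)
    (fderiv ℝ (fun q => coordF F'.toFun (transportChart f φ) q / coordF F.toFun φ q) p)
    (fun X => by
      rw [hf.hilbertForm_transportChart hφ hp hp2, hs_eq]
      rfl)
    (fun X Y => by
      rw [dHilbertForm, hev.extDeriv_eq, extDeriv_smul_ofSubsingleton_apply hs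
        (differentiableAt_hilbertForm F hφ hp hp2), hs_eq]
      rfl) Z
  rw [volumeForm, hw, volumeForm, Nat.sub_add_cancel hn]
  ring

theorem IsConformal.density_transportChart (hn : 1 ≤ n) (hf : IsConformal F F' f)
    (hφ : φ ∈ IsManifold.maximalAtlas (𝓡 n) ∞ M) {ξ θ : EuclideanSpace ℝ (Fin n)}
    (hξ : ξ ∈ φ.target) (hθ : θ ≠ 0) :
    density F'.toFun (transportChart f φ) ξ θ =
      ENNReal.ofReal (dilation F F' f ⟨φ.symm ξ, dChartSymm φ ξ θ⟩ ^ n) *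
        density F.toFun φ ξ θ := by
  have hd := dilation_pos F F' (f := f) (p := ⟨φ.symm ξ, dChartSymm φ ξ θ⟩)
    (dChartSymm_ne_zero hφ hξ hθ)
  simp only [density, ENNReal.mul_iSup]
  refine iSup_congr fun t => ?_
  rw [hf.volumeForm_transportChart hn hφ (p := (ξ, θ)) hξ hθ, abs_mul, abs_of_pos (pow_pos hd n),
    ENNReal.ofReal_mul (pow_pos hd n).le]

end Volume

theorem withDensity_map {X Y : Type*} [MeasurableSpace X] [MeasurableSpace Y] {g : X → Y}
    (hg : Measurable g) {τ : Y → ℝ≥0∞} (hτ : Measurable τ) (ν : Measure X) :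
    (ν.map g).withDensity τ = (ν.withDensity (τ ∘ g)).map g := by
  ext s hs
  rw [withDensity_apply _ hs, Measure.map_apply hg hs, withDensity_apply _ (hg hs),
    setLIntegral_map hs hτ hg]
  rfl

section Energy

variable {n : ℕ} {M : Type*} [TopologicalSpace M] [ChartedSpace (EuclideanSpace ℝ (Fin n)) M]
  [IsManifold (𝓡 n) ∞ M]
  {M' : Type*} [TopologicalSpace M'] [ChartedSpace (EuclideanSpace ℝ (Fin n)) M']
  [IsManifold (𝓡 n) ∞ M'] {F : FinslerStructure n M} {F' : FinslerStructure n M'}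
  {f : M ≃ₘ^∞⟮𝓡 n, 𝓡 n⟯ M'}

/-! ### The measures of the volume elements under a conformal map -/

theorem continuous_sphereParam (φ : IsManifold.maximalAtlas (𝓡 n) ∞ M) :
    Continuous (sphereParam φ) := by
  have h := (contMDiffOn_inducedCoordinates φ.2).continuousOn
  have h2 : Continuous fun q : φ.1.target × Metric.sphere (0 : EuclideanSpace ℝ (Fin n)) 1 =>
      (⟨φ.1.symm q.1, dChartSymm φ.1 q.1 q.2⟩ : TangentBundle (𝓡 n) M) :=
    h.comp_continuous (f := fun q : φ.1.target × Metric.sphere (0 : EuclideanSpace ℝ (Fin n)) 1 =>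
      ((q.1 : EuclideanSpace ℝ (Fin n)), (q.2 : EuclideanSpace ℝ (Fin n)))) (by fun_prop)
      fun q => ⟨q.1.2, mem_univ _⟩
  have h3 := h2.subtype_mk (p := fun p : TangentBundle (𝓡 n) M => p.2 ≠ 0) fun q =>
    dChartSymm_ne_zero φ.2 q.1.2 (ne_zero_of_mem_unit_sphere q.2)
  exact (continuous_coinduced_rng (f := toSphereBundle (n := n) (M := M))).comp h3

/-- In corresponding charts the map of sphere bundles is the identity. -/
theorem sphereParam_transportChart (φ : IsManifold.maximalAtlas (𝓡 n) ∞ M)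
    (q : φ.1.target × Metric.sphere (0 : EuclideanSpace ℝ (Fin n)) 1) :
    sphereParam ⟨transportChart f φ.1, transportChart_mem_maximalAtlas f φ.2⟩ q =
      sphereMap f (sphereParam φ q) := by
  have h1 : sphereParam φ q = toSphereBundle ⟨⟨φ.1.symm q.1, dChartSymm φ.1 q.1 q.2⟩,
    dChartSymm_ne_zero φ.2 q.1.2 (ne_zero_of_mem_unit_sphere q.2)⟩ := rfl
  rw [h1, sphereMap_toSphereBundle]
  have h2 := dChartSymm_transportChart f φ.2 q.1.2 q.2
  simp only [sphereParam, toSphereBundle, slitTangentMap, tangentMap]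
  congr 1
  simp only [h2]
  rfl

/-- The density of the volume element of `F'` with respect to that of `F`. -/
def volumeRatio (F : FinslerStructure n M) (F' : FinslerStructure n M')
    (f : M ≃ₘ^∞⟮𝓡 n, 𝓡 n⟯ M') (z : SphereBundle n M) : ℝ≥0∞ :=
  ENNReal.ofReal (sphereDilation F F' f z ^ n)

theorem measurable_volumeRatio : Measurable (volumeRatio F F' f) :=
  (ENNReal.continuous_ofReal.comp ((continuous_sphereDilation F F').pow n)).measurable

theorem volumeRatio_ne_zero (z : SphereBundle n M) : volumeRatio F F' f z ≠ 0 :=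
  (ENNReal.ofReal_pos.2 (pow_pos (sphereDilation_pos F F' z) n)).ne'

theorem volumeRatio_ne_top (z : SphereBundle n M) : volumeRatio F F' f z ≠ ⊤ :=
  ENNReal.ofReal_ne_top

/-- Over corresponding charts the volume of `F'` is the image of the volume of `F` with density the
`n`-th power of the dilation. -/
theorem IsConformal.chartVolume_transportChart (hn : 1 ≤ n) (hf : IsConformal F F' f)
    (φ : IsManifold.maximalAtlas (𝓡 n) ∞ M) :
    chartVolume F' ⟨transportChart f φ.1, transportChart_mem_maximalAtlas f φ.2⟩ =
      ((chartVolume F φ).withDensity (volumeRatio F F' f)).map (sphereHomeomorph f) := by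
  have : SigmaFinite (Measure.comap Subtype.val volume : Measure φ.1.target) :=
    SigmaFinite.of_map _ measurable_subtype_coe.aemeasurable (by
      rw [map_comap_subtype_coe φ.1.open_target.measurableSet]
      infer_instance)
  have hsp := (continuous_sphereParam φ).measurable
  rw [chartVolume, chartVolume, withDensity_map hsp measurable_volumeRatio,
    ← withDensity_mul_of_pos _ _ _ (measurable_volumeRatio.comp hsp)
      (fun q => volumeRatio_ne_zero _) (fun q => volumeRatio_ne_top _),
    Measure.map_map (sphereHomeomorph f).continuous.measurable hsp]
  have h1 : sphereParam ⟨transportChart f φ.1, transportChart_mem_maximalAtlas f φ.2⟩ =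
      sphereHomeomorph f ∘ sphereParam φ := funext (sphereParam_transportChart φ)
  have h2 : (fun q : φ.1.target × Metric.sphere (0 : EuclideanSpace ℝ (Fin n)) 1 =>
      density F'.toFun (transportChart f φ.1) q.1.1 q.2.1) =
      (fun q => density F.toFun φ.1 q.1.1 q.2.1) * (volumeRatio F F' f ∘ sphereParam φ) := by
    funext q
    have hq := ne_zero_of_mem_unit_sphere q.2
    rw [hf.density_transportChart hn φ.2 q.1.2 hq, mul_comm, Pi.mul_apply, Function.comp_apply,
      volumeRatio, sphereParam, sphereDilation_mk]
  rw [← h1, ← h2]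
  rfl

/-- The volume of `F`, in terms of the volume of `F'`. -/
theorem IsConformal.sphereVolume_le (hn : 1 ≤ n) (hf : IsConformal F F' f) :
    sphereVolume F ≤ ((sphereVolume F').map (sphereHomeomorph f).symm).withDensity
      (volumeRatio F F' f)⁻¹ := by
  refine iSup_le fun φ => ?_
  have hle : chartVolume F' ⟨transportChart f φ.1, transportChart_mem_maximalAtlas f φ.2⟩ ≤
      sphereVolume F' := le_iSup (chartVolume F') _
  rw [hf.chartVolume_transportChart hn φ] at hle
  have h := Measure.map_mono hle (sphereHomeomorph f).symm.continuous.measurable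
  rw [Measure.map_map (sphereHomeomorph f).symm.continuous.measurable
    (sphereHomeomorph f).continuous.measurable, Homeomorph.symm_comp_self, Measure.map_id] at h
  refine le_trans (le_of_eq ?_) (withDensity_mono_left h _)
  rw [← withDensity_mul _ measurable_volumeRatio measurable_volumeRatio.inv]
  have h1 : volumeRatio F F' f * (volumeRatio F F' f)⁻¹ = 1 := by
    funext z
    exact ENNReal.mul_inv_cancel (volumeRatio_ne_zero z) (volumeRatio_ne_top z)
  rw [h1, withDensity_one]

/-! ### Conformal invariance of the energy -/

/-- The pullback of a generalized differential is a generalized differential, since the coordinate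
expressions of `u ∘ f` in a chart `φ` are those of `u` in the chart `φ ∘ f⁻¹`. -/
theorem IsWeakDifferential.comp {u : M' → ℝ} {α' : ∀ x : M', TangentSpace (𝓡 n) x →L[ℝ] ℝ}
    (h : IsWeakDifferential u α') (f : M ≃ₘ^∞⟮𝓡 n, 𝓡 n⟯ M') :
    IsWeakDifferential (u ∘ f) fun x => (α' (f x)).comp (mfderiv (𝓡 n) (𝓡 n) f x) := by
  intro φ hφ
  obtain ⟨h1, h2⟩ := h _ (transportChart_mem_maximalAtlas f hφ)
  have heq : ∀ ξ ∈ φ.target, ∀ e : EuclideanSpace ℝ (Fin n),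
      α' ((transportChart f φ).symm ξ) (dChartSymm (transportChart f φ) ξ e) =
      (α' (f (φ.symm ξ))).comp (mfderiv (𝓡 n) (𝓡 n) f (φ.symm ξ)) (dChartSymm φ ξ e) := by
    intro ξ hξ e
    rw [dChartSymm_transportChart f hφ hξ]
    rfl
  refine ⟨?_, fun ψ hψ hψc hψs e => ?_⟩
  · have heq' : EqOn (fun ξ => ((α' ((transportChart f φ).symm ξ)).comp
          (dChartSymm (transportChart f φ) ξ) : EuclideanSpace ℝ (Fin n) →L[ℝ] ℝ))
        (fun ξ => (((α' (f (φ.symm ξ))).comp (mfderiv (𝓡 n) (𝓡 n) f (φ.symm ξ))).comp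
          (dChartSymm φ ξ) : EuclideanSpace ℝ (Fin n) →L[ℝ] ℝ)) φ.target :=
      fun ξ hξ => ContinuousLinearMap.ext (heq ξ hξ)
    exact h1.congr (ae_restrict_of_forall_mem φ.open_target.measurableSet heq')
  · refine (h2 ψ hψ hψc hψs e).trans ?_
    congr 1
    refine integral_congr_ae (ae_of_all _ fun ξ => ?_)
    by_cases hξ : ξ ∈ φ.target
    · exact congrArg (· * ψ ξ) (heq ξ hξ e)
    · have : ψ ξ = 0 := image_eq_zero_of_notMem_tsupport fun h => hξ (hψs h)
      simp only [this, mul_zero]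

theorem IsConformal.energy_comp_le (hn : 1 ≤ n) (hf : IsConformal F F' f) (u : M' → ℝ) :
    energy F (u ∘ f) ≤ energy F' u := by
  refine le_iInf₂ fun α' hα' => ?_
  refine (iInf₂_le _ (hα'.comp f)).trans ?_
  refine (lintegral_mono' (hf.sphereVolume_le hn) le_rfl).trans ?_
  rw [lintegral_withDensity_eq_lintegral_mul_non_measurable _ measurable_volumeRatio.inv
    (ae_of_all _ fun z => ENNReal.inv_lt_top.2 (pos_iff_ne_zero.2 (volumeRatio_ne_zero z))),
    show Measure.map (sphereHomeomorph f).symm (sphereVolume F') =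
      Measure.map (sphereHomeomorph f).toMeasurableEquiv.symm (sphereVolume F') from rfl,
    lintegral_map_equiv]
  refine lintegral_mono fun z' => le_of_eq ?_
  obtain ⟨z, rfl⟩ := (sphereHomeomorph f).surjective z'
  have hz : (sphereHomeomorph f).toMeasurableEquiv.symm (sphereHomeomorph f z) = z :=
    (sphereHomeomorph f).symm_apply_apply z
  have hs := pow_pos (sphereDilation_pos F F' (f := f) z) n
  rw [hz, Pi.mul_apply, Pi.inv_apply, ← hf.normGradLift_mul α' z, mul_pow,
    ENNReal.ofReal_mul hs.le]
  exact ENNReal.inv_mul_cancel_left (volumeRatio_ne_zero z) (volumeRatio_ne_top z)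

theorem IsConformal.energy_comp (hn : 1 ≤ n) (hf : IsConformal F F' f) (u : M' → ℝ) :
    energy F (u ∘ f) = energy F' u := by
  refine le_antisymm (hf.energy_comp_le hn u) ?_
  have h := hf.symm.energy_comp_le hn (u ∘ f)
  rwa [Function.comp_assoc, show f ∘ f.symm = id from funext f.apply_symm_apply,
    Function.comp_id] at h

end Energy

/-! ### Continua under homeomorphisms -/

section Continua

variable {X Y : Type*} [TopologicalSpace X] [TopologicalSpace Y]

theorem IsCompactContinuum.preimage (h : X ≃ₜ Y) {C : Set Y} (hC : IsCompactContinuum C) :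
    IsCompactContinuum (h ⁻¹' C) :=
  ⟨hC.1.preimage h.continuous, h.isConnected_preimage.2 hC.2.1,
    hC.2.2.1.preimage h.surjective, h.isCompact_preimage.2 hC.2.2.2⟩

theorem IsRelativeContinuum.preimage (h : X ≃ₜ Y) {C : Set Y} (hC : IsRelativeContinuum C) :
    IsRelativeContinuum (h ⁻¹' C) := by
  refine ⟨hC.1.preimage h.continuous, ?_⟩
  have e : ((↑) '' (h ⁻¹' C) ∪ {OnePoint.infty} : Set (OnePoint X)) =
      h.symm.onePointCongr '' ((↑) '' C ∪ {OnePoint.infty}) := by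
    rw [← h.image_symm, image_union, image_image, image_image, image_singleton]
    rfl
  rw [e]
  exact hC.2.image _ h.symm.onePointCongr.continuous.continuousOn

end Continua

section Capacity

variable {n : ℕ} {M : Type*} [TopologicalSpace M] [ChartedSpace (EuclideanSpace ℝ (Fin n)) M]
  [IsManifold (𝓡 n) ∞ M]
  {M' : Type*} [TopologicalSpace M'] [ChartedSpace (EuclideanSpace ℝ (Fin n)) M']
  [IsManifold (𝓡 n) ∞ M'] {F : FinslerStructure n M} {F' : FinslerStructure n M'}
  {f : M ≃ₘ^∞⟮𝓡 n, 𝓡 n⟯ M'}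

/-! ### Conformal invariance of capacities -/

theorem IsConformal.comp_mem_H (hn : 1 ≤ n) (hf : IsConformal F F' f) {u : M' → ℝ}
    (hu : u ∈ H F') : u ∘ f ∈ H F := by
  obtain ⟨hc, ⟨α', hα'⟩, he⟩ := hu
  exact ⟨hc.comp f.continuous, ⟨_, hα'.comp f⟩, (hf.energy_comp hn u).trans_lt he⟩

theorem IsConformal.comp_mem_H₀ (hn : 1 ≤ n) (hf : IsConformal F F' f) {u : M' → ℝ}
    (hu : u ∈ H₀ F') : u ∘ f ∈ H₀ F :=
  ⟨hf.comp_mem_H hn hu.1, hu.2.comp_homeomorph (sphereHomeomorph f)⟩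

theorem IsConformal.cap_preimage_le (hn : 1 ≤ n) (hf : IsConformal F F' f) (C : Set M') :
    cap F (f ⁻¹' C) ≤ cap F' C := by
  refine le_iInf₂ fun u hu => ?_
  obtain ⟨hu₀, hu1, hu2⟩ := hu
  exact (iInf₂_le (u ∘ f) ⟨hf.comp_mem_H₀ hn hu₀, fun x hx => hu1 _ hx, fun x => hu2 _⟩).trans
    (hf.energy_comp hn u).le

theorem IsConformal.condenserCap_preimage_le (hn : 1 ≤ n) (hf : IsConformal F F' f)
    (C₀ C₁ : Set M') : condenserCap F (f ⁻¹' C₀) (f ⁻¹' C₁) ≤ condenserCap F' C₀ C₁ := by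
  refine le_iInf₂ fun u hu => ?_
  obtain ⟨hu₀, hu1, hu2, hu3⟩ := hu
  exact (iInf₂_le (u ∘ f) ⟨hf.comp_mem_H hn hu₀, fun x hx => hu1 _ hx, fun x hx => hu2 _ hx,
    fun x => hu3 _⟩).trans (hf.energy_comp hn u).le

theorem IsConformal.mu_le (hn : 1 ≤ n) (hf : IsConformal F F' f) (x₁ x₂ : M) :
    mu F x₁ x₂ ≤ mu F' (f x₁) (f x₂) := by
  refine le_iInf₂ fun C hC => ?_
  exact (iInf₂_le (f ⁻¹' C) ⟨hC.1.preimage f.toHomeomorph, hC.2⟩).trans (hf.cap_preimage_le hn C)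

theorem IsConformal.lam_le (hn : 1 ≤ n) (hf : IsConformal F F' f) (x₁ x₂ : M) :
    lam F x₁ x₂ ≤ lam F' (f x₁) (f x₂) := by
  refine le_iInf₂ fun C₀ h₀ => le_iInf₂ fun C₁ h₁ => ?_
  exact (iInf₂_le_of_le (f ⁻¹' C₀) ⟨h₀.1.preimage f.toHomeomorph, h₀.2⟩
    (iInf₂_le (f ⁻¹' C₁) ⟨h₁.1.preimage f.toHomeomorph, h₁.2⟩)).trans
    (hf.condenserCap_preimage_le hn C₀ C₁)

theorem IsConformal.nu_le (hn : 1 ≤ n) (hf : IsConformal F F' f) (x₁ x₂ x₃ : M) :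
    nu F x₁ x₂ x₃ ≤ nu F' (f x₁) (f x₂) (f x₃) := by
  refine le_iInf₂ fun C₀ h₀ => le_iInf₂ fun C₁ h₁ => ?_
  exact (iInf₂_le_of_le (f ⁻¹' C₀) ⟨h₀.1.preimage f.toHomeomorph, h₀.2⟩
    (iInf₂_le (f ⁻¹' C₁) ⟨h₁.1.preimage f.toHomeomorph, h₁.2⟩)).trans
    (hf.condenserCap_preimage_le hn C₀ C₁)

theorem IsConformal.rho_le (hn : 1 ≤ n) (hf : IsConformal F F' f) (x₁ x₂ x₃ x₄ : M) :
    rho F x₁ x₂ x₃ x₄ ≤ rho F' (f x₁) (f x₂) (f x₃) (f x₄) := by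
  have hiff : (({x₁, x₂} : Set M) ∩ {x₃, x₄}).Nonempty ↔
      (({f x₁, f x₂} : Set M') ∩ {f x₃, f x₄}).Nonempty := by
    rw [← image_pair, ← image_pair, ← image_inter (f := f) f.injective, image_nonempty]
  rw [rho, rho]
  by_cases h : (({x₁, x₂} : Set M) ∩ {x₃, x₄}).Nonempty
  · rw [if_pos h, if_pos (hiff.1 h)]
  · rw [if_neg h, if_neg (fun h' => h (hiff.2 h'))]
    refine le_iInf₂ fun C₀ h₀ => le_iInf₂ fun C₁ h₁ => ?_
    exact (iInf₂_le_of_le (f ⁻¹' C₀) ⟨h₀.1.preimage f.toHomeomorph, h₀.2⟩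
      (iInf₂_le (f ⁻¹' C₁) ⟨h₁.1.preimage f.toHomeomorph, h₁.2⟩)).trans
      (hf.condenserCap_preimage_le hn C₀ C₁)

end Capacity
end FinslerConformal

end

theorem theorem2 {n : ℕ} (hn : 2 ≤ n)
    {M : Type*} [TopologicalSpace M] [T2Space M] [SecondCountableTopology M] [ConnectedSpace M]
    [ChartedSpace (EuclideanSpace ℝ (Fin n)) M] [IsManifold (𝓡 n) ∞ M]
    {M' : Type*} [TopologicalSpace M'] [T2Space M'] [SecondCountableTopology M']
    [ConnectedSpace M'] [ChartedSpace (EuclideanSpace ℝ (Fin n)) M'] [IsManifold (𝓡 n) ∞ M']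
    (F : FinslerConformal.FinslerStructure n M) (F' : FinslerConformal.FinslerStructure n M')
    (f : M ≃ₘ^∞⟮𝓡 n, 𝓡 n⟯ M') (hf : FinslerConformal.IsConformal F F' f) :
    (∀ x₁ x₂ x₃ x₄ : M, FinslerConformal.rho F x₁ x₂ x₃ x₄ =
      FinslerConformal.rho F' (f x₁) (f x₂) (f x₃) (f x₄)) ∧
    (∀ x₁ x₂ x₃ : M, FinslerConformal.nu F x₁ x₂ x₃ =
      FinslerConformal.nu F' (f x₁) (f x₂) (f x₃)) ∧
    (∀ x₁ x₂ : M, FinslerConformal.mu F x₁ x₂ = FinslerConformal.mu F' (f x₁) (f x₂)) ∧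
    (∀ x₁ x₂ : M, FinslerConformal.lam F x₁ x₂ = FinslerConformal.lam F' (f x₁) (f x₂)) := by
  have hn1 : 1 ≤ n := by omega
  refine ⟨fun x₁ x₂ x₃ x₄ => le_antisymm (hf.rho_le hn1 _ _ _ _) ?_,
    fun x₁ x₂ x₃ => le_antisymm (hf.nu_le hn1 _ _ _) ?_,
    fun x₁ x₂ => le_antisymm (hf.mu_le hn1 _ _) ?_,
    fun x₁ x₂ => le_antisymm (hf.lam_le hn1 _ _) ?_⟩
  · simpa using hf.symm.rho_le hn1 (f x₁) (f x₂) (f x₃) (f x₄)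
  · simpa using hf.symm.nu_le hn1 (f x₁) (f x₂) (f x₃)
  · simpa using hf.symm.mu_le hn1 (f x₁) (f x₂)
  · simpa using hf.symm.lam_le hn1 (f x₁) (f x₂)
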